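/- Let $\mathbb O=\mathbb H\oplus\mathbb H$ be the octonions with product $(q_1,q_2)(p_1,p_2)=(q_1p_1-\bar p_2q_2,\;p_2q_1+q_2\bar p_1)$, conjugation $\overline{(q_1,q_2)}=(\bar q_1,-q_2)$, inner product $\langle x,y\rangle=\mathrm{Re}(x\bar y)$ and $|x|^2=\langle x,x\rangle$. Put $$U_1=\{(1,u,v)\in\mathbb O^3: 1+|u|^2-|v|^2>0\},\qquad U_2=\{(u,1,v)\in\mathbb O^3: |u|^2+1-|v|^2>0\}.$$ The relation $(a,b,c)\sim(d,e,f)\iff a=d\lambda,\ b=e\lambda,\ c=f\lambda$ for some $\lambda\in\mathbb O\setminus\{0\}$ is an equivalence relation on $U_1\cup U_2$. The indefinite octonionic projective plane is $\mathbb OP^{(1,1)}=(U_1\cup U_2)/\!\sim$, with the quotient topology and the smooth structure given by the two charts $[1,u,v]\mapsto(u,v)$ on $U_1/\!\sim$ and $[u,1,v]\mapsto(u,v)$ on $U_2/\!\sim$. Its metric $g$ is given in both charts by $$ds^2=\frac{|du|^2(1-|v|^2)-|dv|^2(1+|u|^2)+2\,\mathrm{Re}[(u\bar v)(dv\,d\bar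 u)]}{(1+|u|^2-|v|^2)^2}.$$ Let $R$ be its Riemann curvature tensor, with the sign convention $R(x,y)=\nabla_{[x,y]}-[\nabla_x,\nabla_y]$, let $\mathcal J_v(x)=R(v,x)v$ be the Jacobi operator, write $\varepsilon_v=g(v,v)$, and call a tangent vector $v$ unit if $\varepsilon_v=\pm1$. **Theorem.** The two chart expressions agree on the overlap and define a smooth non-degenerate metric $g$ of signature $(8,8)$ on $\mathbb OP^{(1,1)}$, and $(\mathbb OP^{(1,1)},g)$ is a special Osserman manifold. That is, with $\lambda=4$ and $\mu=1$, the following hold at every point $P$, for all $v,w\in T_P\mathbb OP^{(1,1)}$ with $v$ unit: 1. $\mathcal J_v$ maps $v^\perp$ to itself, is diagonalizable there, and its non-zero eigenvalues on $v^\perp$ are exactly $\varepsilon_v\lambda$ and $\varepsilon_v\mu$; 2. with $E_\lambda(v)=\mathrm{span}\{v\}\oplus\ker(\mathcal J_v-\varepsilon_v\lambda\,\mathrm{Id})$: if $w$ is unit and $w\in E_\lambda(v)$, then $E_\lambda(w)=E_\lambda(v)$; 3. if $w\in\ker(\mathcal J_v-\varepsilon_v\mu\,\mathrm{Id})$, then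 $v\in\ker(\mathcal J_w-\varepsilon_w\mu\,\mathrm{Id})$. Moreover the eigenvalues $4\varepsilon_v$ and $\varepsilon_v$ have multiplicities $7$ and $8$. Finally, identify the tangent space at $P_0=[1,0,0]$ with $\mathbb O^2$ by the first chart. For a unit vector $(a,b)$ at $P_0$, $$\ker(\mathcal J_{(a,b)}-4\varepsilon_{(a,b)}\mathrm{Id})=\begin{cases}\big\{\big(c,\tfrac1{|a|^2}(b\bar a)c\big): c\in\mathbb O,\ c\perp a\big\}&\text{if }|a|\neq0,\\[1ex]\big\{\big(\tfrac1{|b|^2}(a\bar b)d,d\big): d\in\mathbb O,\ d\perp b\big\}&\text{if }|b|\neq0,\end{cases}$$ $$\ker(\mathcal J_{(a,b)}-\varepsilon_{(a,b)}\mathrm{Id})=\begin{cases}\big\{\big(\tfrac1{|a|^2}(a\bar b)d,d\big): d\in\mathbb O\big\}&\text{if }|a|\neq0,\\[1ex]\big\{\big(c,\tfrac1{|b|^2}(b\bar a)c\big): c\in\mathbb O\big\}&\text{if }|b|\neq0,\end{cases}$$ where both descriptions are valid when $a$ and $b$ are both non-zero. -/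

import Mathlib

set_option maxSynthPendingDepth 3

open scoped Quaternion Manifold ContDiff

noncomputable section

/-- The octonions, as pairs of quaternions. -/
@[ext] structure Octonion where
  /-- The first quaternion component. -/
  left : ℍ[ℝ]
  /-- The second quaternion component. -/
  right : ℍ[ℝ]

namespace Octonion

instance : Zero Octonion := ⟨⟨0, 0⟩⟩
instance : Add Octonion := ⟨fun x y => ⟨x.left + y.left, x.right + y.right⟩⟩
instance : Neg Octonion := ⟨fun x => ⟨-x.left, -x.right⟩⟩
instance : Sub Octonion := ⟨fun x y => ⟨x.left - y.left, x.right - y.right⟩⟩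
instance : SMul ℝ Octonion := ⟨fun r x => ⟨r • x.left, r • x.right⟩⟩

@[simp] theorem left_add (x y : Octonion) : (x + y).left = x.left + y.left := rfl
@[simp] theorem right_add (x y : Octonion) : (x + y).right = x.right + y.right := rfl
@[simp] theorem left_neg (x : Octonion) : (-x).left = -x.left := rfl
@[simp] theorem right_neg (x : Octonion) : (-x).right = -x.right := rfl
@[simp] theorem left_sub (x y : Octonion) : (x - y).left = x.left - y.left := rfl
@[simp] theorem right_sub (x y : Octonion) : (x - y).right = x.right - y.right := rfl
@[simp] theorem left_smul (r : ℝ) (x : Octonion) : (r • x).left = r • x.left := rfl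
@[simp] theorem right_smul (r : ℝ) (x : Octonion) : (r • x).right = r • x.right := rfl
@[simp] theorem left_zero : (0 : Octonion).left = 0 := rfl
@[simp] theorem right_zero : (0 : Octonion).right = 0 := rfl

instance : AddCommGroup Octonion where
  add_assoc _ _ _ := Octonion.ext (add_assoc _ _ _) (add_assoc _ _ _)
  zero_add _ := Octonion.ext (zero_add _) (zero_add _)
  add_zero _ := Octonion.ext (add_zero _) (add_zero _)
  neg_add_cancel _ := Octonion.ext (neg_add_cancel _) (neg_add_cancel _)
  add_comm _ _ := Octonion.ext (add_comm _ _) (add_comm _ _)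
  sub_eq_add_neg _ _ := Octonion.ext (sub_eq_add_neg _ _) (sub_eq_add_neg _ _)
  nsmul := nsmulRec
  zsmul := zsmulRec

instance : Module ℝ Octonion where
  one_smul _ := Octonion.ext (one_smul _ _) (one_smul _ _)
  mul_smul _ _ _ := Octonion.ext (mul_smul _ _ _) (mul_smul _ _ _)
  smul_zero _ := Octonion.ext (smul_zero _) (smul_zero _)
  smul_add _ _ _ := Octonion.ext (smul_add _ _ _) (smul_add _ _ _)
  add_smul _ _ _ := Octonion.ext (add_smul _ _ _) (add_smul _ _ _)
  zero_smul _ := Octonion.ext (zero_smul _ _) (zero_smul _ _)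

/-- The octonions as a real vector space. -/
def equivProd : Octonion ≃ₗ[ℝ] ℍ[ℝ] × ℍ[ℝ] where
  toFun x := (x.left, x.right)
  invFun q := ⟨q.1, q.2⟩
  map_add' _ _ := rfl
  map_smul' _ _ := rfl
  left_inv _ := rfl
  right_inv _ := rfl

instance : FiniteDimensional ℝ Octonion := equivProd.symm.finiteDimensional

/-- The Cayley–Dickson product `(q₁,q₂)(p₁,p₂) = (q₁p₁ - p̄₂q₂, p₂q₁ + q₂p̄₁)`. -/
instance : Mul Octonion :=
  ⟨fun x y => ⟨x.left * y.left - star y.right * x.right,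
    y.right * x.left + x.right * star y.left⟩⟩

instance : One Octonion := ⟨⟨1, 0⟩⟩

/-- Octonionic conjugation. -/
instance : Star Octonion := ⟨fun x => ⟨star x.left, -x.right⟩⟩

/-- The real part. -/
def re (x : Octonion) : ℝ := x.left.re

@[simp] theorem left_one : (1 : Octonion).left = 1 := rfl
@[simp] theorem right_one : (1 : Octonion).right = 0 := rfl
@[simp] theorem left_mul (x y : Octonion) :
    (x * y).left = x.left * y.left - star y.right * x.right := rfl
@[simp] theorem right_mul (x y : Octonion) :
    (x * y).right = y.right * x.left + x.right * star y.left := rfl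
@[simp] theorem left_star (x : Octonion) : (star x).left = star x.left := rfl
@[simp] theorem right_star (x : Octonion) : (star x).right = -x.right := rfl

/-- The inner product `⟨x, y⟩ = Re (x ȳ)`. -/
instance : Inner ℝ Octonion := ⟨fun x y => re (x * star y)⟩

theorem inner_eq_re (x y : Octonion) : inner ℝ x y = re (x * star y) := rfl

theorem inner_coord (x y : Octonion) : inner ℝ x y =
    x.left.re * y.left.re + x.left.imI * y.left.imI + x.left.imJ * y.left.imJ
      + x.left.imK * y.left.imK
      + (x.right.re * y.right.re + x.right.imI * y.right.imI + x.right.imJ * y.right.imJ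
      + x.right.imK * y.right.imK) := by
  simp [inner_eq_re, re]
  ring

theorem inner_self_nonneg' (x : Octonion) : 0 ≤ inner ℝ x x := by
  rw [inner_coord]
  simp only [← sq]
  positivity

theorem eq_zero_of_inner_self (x : Octonion) (h : inner ℝ x x = 0) : x = 0 := by
  rw [inner_coord] at h
  ext <;> simp <;> nlinarith

instance : NormedAddCommGroup Octonion :=
  @InnerProductSpace.Core.toNormedAddCommGroup ℝ Octonion _ _ _
    { toInner := inferInstance
      conj_inner_symm := fun x y => by
        simp only [inner_coord, conj_trivial]
        ring
      re_inner_nonneg := inner_self_nonneg'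
      definite := eq_zero_of_inner_self
      add_left := fun x y z => by
        simp only [inner_coord, left_add, right_add, Quaternion.re_add, Quaternion.imI_add,
          Quaternion.imJ_add, Quaternion.imK_add]
        ring
      smul_left := fun x y r => by
        simp only [inner_coord, left_smul, right_smul, Quaternion.re_smul, Quaternion.imI_smul,
          Quaternion.imJ_smul, Quaternion.imK_smul, smul_eq_mul, conj_trivial]
        ring }

instance : InnerProductSpace ℝ Octonion := InnerProductSpace.ofCore _

/-- The inverse `x⁻¹ = x̄ / |x|²` (with `0⁻¹ = 0`). -/
instance : Inv Octonion := ⟨fun x => (‖x‖ ^ 2)⁻¹ • star x⟩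

theorem inv_def (x : Octonion) : x⁻¹ = (‖x‖ ^ 2)⁻¹ • star x := rfl

theorem norm_sq_coord (x : Octonion) : ‖x‖ ^ 2 =
    x.left.re ^ 2 + x.left.imI ^ 2 + x.left.imJ ^ 2 + x.left.imK ^ 2 +
    (x.right.re ^ 2 + x.right.imI ^ 2 + x.right.imJ ^ 2 + x.right.imK ^ 2) := by
  rw [← real_inner_self_eq_norm_sq, inner_coord]
  ring

theorem mul_mul_star (v x : Octonion) : v * x * star x = ‖x‖ ^ 2 • v := by
  ext <;> simp [norm_sq_coord] <;> ring

theorem mul_star_mul (v x : Octonion) : v * star x * x = ‖x‖ ^ 2 • v := by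
  ext <;> simp [norm_sq_coord] <;> ring

theorem norm_mul (x y : Octonion) : ‖x * y‖ = ‖x‖ * ‖y‖ := by
  rw [← sq_eq_sq₀ (by positivity) (by positivity), mul_pow]
  simp [norm_sq_coord]
  ring

theorem mul_smul (r : ℝ) (x y : Octonion) : x * (r • y) = r • (x * y) := by
  ext <;> simp <;> ring

theorem smul_mul (r : ℝ) (x y : Octonion) : (r • x) * y = r • (x * y) := by
  ext <;> simp <;> ring

theorem mul_add (x y z : Octonion) : x * (y + z) = x * y + x * z := by
  ext <;> simp <;> ring

theorem add_mul (x y z : Octonion) : (x + y) * z = x * z + y * z := by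
  ext <;> simp <;> ring

theorem star_add (x y : Octonion) : star (x + y) = star x + star y := by
  ext <;> simp <;> ring
theorem star_smul (r : ℝ) (x : Octonion) : star (r • x) = r • star x := by
  ext <;> simp 
theorem re_add (x y : Octonion) : re (x + y) = re x + re y := by
  simp [re]
theorem re_smul (r : ℝ) (x : Octonion) : re (r • x) = r * re x := by
  simp [re]

theorem one_mul (x : Octonion) : 1 * x = x := by ext <;> simp
theorem mul_one (x : Octonion) : x * 1 = x := by ext <;> simp
theorem zero_mul (x : Octonion) : 0 * x = 0 := by ext <;> simp
theorem mul_zero (x : Octonion) : x * 0 = 0 := by ext <;> simp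

theorem norm_one : ‖(1 : Octonion)‖ = 1 := by
  rw [← sq_eq_sq₀ (by positivity) (by positivity)]
  simp [norm_sq_coord]

theorem norm_star (x : Octonion) : ‖star x‖ = ‖x‖ := by
  rw [← sq_eq_sq₀ (by positivity) (by positivity)]
  simp [norm_sq_coord]

theorem norm_inv (x : Octonion) : ‖x⁻¹‖ = ‖x‖⁻¹ := by
  by_cases hx : x = 0
  · subst hx
    simp [inv_def]
  · have hx' : ‖x‖ ≠ 0 := norm_ne_zero_iff.2 hx
    rw [inv_def, norm_smul, norm_star, Real.norm_of_nonneg (by positivity)]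
    field_simp

theorem inv_ne_zero {x : Octonion} (hx : x ≠ 0) : x⁻¹ ≠ 0 := by
  rw [← norm_ne_zero_iff, norm_inv]
  exact _root_.inv_ne_zero (norm_ne_zero_iff.2 hx)

theorem mul_mul_inv {x : Octonion} (hx : x ≠ 0) (v : Octonion) : v * x * x⁻¹ = v := by
  have hx' : ‖x‖ ^ 2 ≠ 0 := pow_ne_zero 2 (norm_ne_zero_iff.2 hx)
  rw [inv_def, mul_smul, mul_mul_star, smul_smul, inv_mul_cancel₀ hx', one_smul]

theorem mul_inv_mul {x : Octonion} (hx : x ≠ 0) (v : Octonion) : v * x⁻¹ * x = v := by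
  have hx' : ‖x‖ ^ 2 ≠ 0 := pow_ne_zero 2 (norm_ne_zero_iff.2 hx)
  rw [inv_def, mul_smul, smul_mul, mul_star_mul, smul_smul, inv_mul_cancel₀ hx', one_smul]

theorem mul_inv_self {x : Octonion} (hx : x ≠ 0) : x * x⁻¹ = 1 := by
  simpa only [one_mul] using mul_mul_inv hx 1

theorem inv_mul_self {x : Octonion} (hx : x ≠ 0) : x⁻¹ * x = 1 := by
  simpa only [one_mul] using mul_inv_mul hx 1

theorem one_ne_zero : (1 : Octonion) ≠ 0 := by
  rw [← norm_ne_zero_iff, norm_one]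
  exact _root_.one_ne_zero

theorem inv_one : (1 : Octonion)⁻¹ = 1 := by
  simpa only [one_mul] using mul_inv_self one_ne_zero

theorem mul_ne_zero {x y : Octonion} (hx : x ≠ 0) (hy : y ≠ 0) : x * y ≠ 0 := by
  rw [← norm_ne_zero_iff, norm_mul]
  exact _root_.mul_ne_zero (norm_ne_zero_iff.2 hx) (norm_ne_zero_iff.2 hy)

theorem eq_inv_of_mul_eq_one {x y : Octonion} (h : x * y = 1) : x = y⁻¹ := by
  have hy : y ≠ 0 := by
    rintro rfl
    rw [mul_zero] at h
    exact one_ne_zero h.symm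
  rw [← mul_mul_inv hy x, h, one_mul]

theorem inv_inv {x : Octonion} (hx : x ≠ 0) : x⁻¹⁻¹ = x :=
  (eq_inv_of_mul_eq_one (mul_inv_self hx)).symm

/-- Multiplication as a bilinear map. -/
def mulL : Octonion →L[ℝ] Octonion →L[ℝ] Octonion :=
  (LinearMap.mk₂ ℝ (fun x y : Octonion => x * y) add_mul smul_mul mul_add
    mul_smul).toContinuousBilinearMap

/-- Conjugation as a linear map. -/
def starL : Octonion →L[ℝ] Octonion :=
  LinearMap.toContinuousLinearMap
    { toFun := fun x : Octonion => star x, map_add' := star_add, map_smul' := star_smul }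

theorem contDiff_mul {n : WithTop ℕ∞} : ContDiff ℝ n (fun x : Octonion × Octonion => x.1 * x.2) :=
  mulL.isBoundedBilinearMap.contDiff

theorem contDiffAt_inv {n : WithTop ℕ∞} {x : Octonion} (hx : x ≠ 0) :
    ContDiffAt ℝ n (fun x : Octonion => x⁻¹) x := by
  have h : ContDiffAt ℝ n (fun x : Octonion => (‖x‖ ^ 2)⁻¹ • starL x) x :=
    ((contDiff_norm_sq ℝ).contDiffAt.inv (pow_ne_zero 2 (norm_ne_zero_iff.2 hx))).smul
      starL.contDiff.contDiffAt
  exact h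

end Octonion

/-! ### Semi-Riemannian metrics, curvature, and the special Osserman conditions -/

namespace SemiRiemannian

section Coordinates

variable {E : Type*} [NormedAddCommGroup E] [NormedSpace ℝ E]

/-- Christoffel symbols of the first kind of a metric `G` given on (an open subset of) a vector
space: `(v, w, z) ↦ ½ (∂_v G(w,z) + ∂_w G(v,z) - ∂_z G(v,w))` at the point `p`. -/
def christoffelLower (G : E → E →L[ℝ] E →L[ℝ] ℝ) (p : E) : E →L[ℝ] E →L[ℝ] E →L[ℝ] ℝ :=
  let D : E →L[ℝ] E →L[ℝ] E →L[ℝ] ℝ := fderiv ℝ G p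
  let F : (E →L[ℝ] E →L[ℝ] ℝ) →L[ℝ] E →L[ℝ] E →L[ℝ] ℝ :=
    (ContinuousLinearMap.flipₗᵢ ℝ E E ℝ).toContinuousLinearEquiv
  let D' : E →L[ℝ] E →L[ℝ] E →L[ℝ] ℝ := F ∘L D.flip
  (1 / 2 : ℝ) • (D + D.flip - D')

theorem christoffelLower_apply (G : E → E →L[ℝ] E →L[ℝ] ℝ) (p v w z : E) :
    christoffelLower G p v w z =
      (1 / 2) * (fderiv ℝ G p v w z + fderiv ℝ G p w v z - fderiv ℝ G p z v w) := rfl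

/-- Christoffel symbols of the second kind, `Γ_p(v, w)`: the index is raised with the inverse of
`G p`, viewed as a map from vectors to covectors. -/
def christoffel (G : E → E →L[ℝ] E →L[ℝ] ℝ) (p : E) : E →L[ℝ] E →L[ℝ] E :=
  (ContinuousLinearMap.compL ℝ E (E →L[ℝ] ℝ) E (G p).inverse) ∘L christoffelLower G p

theorem christoffel_apply (G : E → E →L[ℝ] E →L[ℝ] ℝ) (p v w : E) :
    christoffel G p v w = (G p).inverse (christoffelLower G p v w) := rfl

/-- The Riemann curvature `R(x, y) z` of the Levi-Civita connection of `G` at `p`, with the sign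
convention `R(x, y) = ∇_[x,y] - [∇_x, ∇_y]`, for which `G(R(x, y) x, y)` is positive on the round
sphere. -/
def curvature (G : E → E →L[ℝ] E →L[ℝ] ℝ) (p x y z : E) : E :=
  fderiv ℝ (christoffel G) p y x z - fderiv ℝ (christoffel G) p x y z
    + christoffel G p y (christoffel G p x z) - christoffel G p x (christoffel G p y z)

/-- The Jacobi operator `x ↦ R(v, x) v` of `G` at `p`. -/
def coordJacobi (G : E → E →L[ℝ] E →L[ℝ] ℝ) (p v : E) : Module.End ℝ E where
  toFun x := curvature G p v x v
  map_add' x y := by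
    simp only [curvature, map_add, add_apply]
    abel
  map_smul' r x := by
    simp only [curvature, map_smul, smul_apply, RingHom.id_apply, smul_sub,
      smul_add]

end Coordinates

section Manifold

variable {E : Type*} [NormedAddCommGroup E] [NormedSpace ℝ E]
variable {M : Type*} [TopologicalSpace M] [ChartedSpace E M]

/-- A field of bilinear forms on the tangent spaces of `M`. -/
abbrev BilinField (E : Type*) [NormedAddCommGroup E] [NormedSpace ℝ E]
    (M : Type*) [TopologicalSpace M] [ChartedSpace E M] : Type _ :=
  (p : M) → TangentSpace 𝓘(ℝ, E) p →L[ℝ] TangentSpace 𝓘(ℝ, E) p →L[ℝ] ℝ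

variable [IsManifold 𝓘(ℝ, E) ∞ M]

/-- The expression of `g` in the preferred chart around `x`: at a point `y` of the target of the
chart, corresponding to `q ∈ M`, coordinate vectors are first turned into tangent vectors at `q`. -/
def inChart (g : BilinField E M) (x : M) (y : E) : E →L[ℝ] E →L[ℝ] ℝ :=
  let q : M := (chartAt E x).symm y
  ContinuousLinearMap.bilinearComp (E := E) (F := E) (g q)
    (tangentCoordChange 𝓘(ℝ, E) x q q) (tangentCoordChange 𝓘(ℝ, E) x q q)

/-- `g` is a semi-Riemannian metric: symmetric, non-degenerate, and smooth in charts. -/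
structure IsMetric (g : BilinField E M) : Prop where
  symm : ∀ (p : M) (v w : TangentSpace 𝓘(ℝ, E) p), g p v w = g p w v
  nondegenerate : ∀ (p : M) (v : TangentSpace 𝓘(ℝ, E) p), (∀ w, g p v w = 0) → v = 0
  smooth : ∀ x : M, ContDiffOn ℝ ∞ (inChart g x) (chartAt E x).target

/-- `g` has signature `(r, s)` at every point. -/
def HasSignature (g : BilinField E M) (r s : ℕ) : Prop :=
  ∀ p : M, sigPos (LinearMap.BilinMap.toQuadraticMap (g p).toBilinForm) = r ∧
    sigNeg (LinearMap.BilinMap.toQuadraticMap (g p).toBilinForm) = s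

/-- The Jacobi operator `𝒥_v : x ↦ R(v, x) v` on `T_p M`. The curvature is computed in the preferred
chart around `p`; the tangent space at `p` is, by its definition, identified with the model space
by means of this chart. -/
def jacobi (g : BilinField E M) (p : M) (v : TangentSpace 𝓘(ℝ, E) p) :
    Module.End ℝ (TangentSpace 𝓘(ℝ, E) p) :=
  coordJacobi (E := E) (inChart g p) (chartAt E p p) v

/-- Unit tangent vectors: `g(v, v) = ±1`. -/
def IsUnitVector (g : BilinField E M) (p : M) (v : TangentSpace 𝓘(ℝ, E) p) : Prop :=
  g p v v = 1 ∨ g p v v = -1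

/-- The orthogonal complement `v^⊥`. -/
def perp (g : BilinField E M) (p : M) (v : TangentSpace 𝓘(ℝ, E) p) :
    Submodule ℝ (TangentSpace 𝓘(ℝ, E) p) :=
  LinearMap.ker (g p v).toLinearMap

/-- The eigenspace `ker (𝒥_v - ε_v t)`, where `ε_v = g(v, v)`. -/
def jacobiEigenspace (g : BilinField E M) (p : M) (v : TangentSpace 𝓘(ℝ, E) p) (t : ℝ) :
    Submodule ℝ (TangentSpace 𝓘(ℝ, E) p) :=
  LinearMap.ker (jacobi g p v - (g p v v * t) • LinearMap.id)

/-- The space `E_t(v) = span {v} + ker (𝒥_v - ε_v t)`. -/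
def extendedEigenspace (g : BilinField E M) (p : M) (v : TangentSpace 𝓘(ℝ, E) p) (t : ℝ) :
    Submodule ℝ (TangentSpace 𝓘(ℝ, E) p) :=
  Submodule.span ℝ {v} ⊔ jacobiEigenspace g p v t

/-- `(M, g)` is a special Osserman manifold, with the constants `l` and `m` (called `λ` and `μ` in the
literature), which depend neither on the point nor on the unit vector. -/
structure IsSpecialOssermanWith (g : BilinField E M) (l m : ℝ) : Prop where
  isMetric : IsMetric g
  left_ne_zero : l ≠ 0
  right_ne_zero : m ≠ 0
  ne : l ≠ m
  /-- For a unit vector `v` the operator `𝒥_v` maps `v^⊥` to itself, is diagonalizable there, and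
  its nonzero eigenvalues on `v^⊥` are exactly `ε_v l` and `ε_v m`. -/
  condition_I : ∀ (p : M) (v : TangentSpace 𝓘(ℝ, E) p), IsUnitVector g p v →
    ∃ h : ∀ x ∈ perp g p v, jacobi g p v x ∈ perp g p v,
      (⨆ t : ℝ, Module.End.eigenspace ((jacobi g p v).restrict h) t) = ⊤ ∧
      {t : ℝ | t ≠ 0 ∧ Module.End.HasEigenvalue ((jacobi g p v).restrict h) t} =
        {g p v v * l, g p v v * m}
  condition_II : ∀ (p : M) (v w : TangentSpace 𝓘(ℝ, E) p), IsUnitVector g p v →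
    IsUnitVector g p w → w ∈ extendedEigenspace g p v l →
      extendedEigenspace g p v l = extendedEigenspace g p w l
  condition_III : ∀ (p : M) (v w : TangentSpace 𝓘(ℝ, E) p), IsUnitVector g p v →
    w ∈ jacobiEigenspace g p v m → v ∈ jacobiEigenspace g p w m

end Manifold

end SemiRiemannian

/-! ### The indefinite octonionic projective plane -/

namespace OP11

/-- The affine piece `{(1, u, v) : 1 + |u|² - |v|² > 0}` of `𝕆³`. -/
def U₁ : Set (Octonion × Octonion × Octonion) :=
  {t | t.1 = 1 ∧ 0 < 1 + ‖t.2.1‖ ^ 2 - ‖t.2.2‖ ^ 2}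

/-- The affine piece `{(u, 1, v) : |u|² + 1 - |v|² > 0}` of `𝕆³`. -/
def U₂ : Set (Octonion × Octonion × Octonion) :=
  {t | t.2.1 = 1 ∧ 0 < ‖t.1‖ ^ 2 + 1 - ‖t.2.2‖ ^ 2}

/-- The relation `[a,b,c] ∼ [d,e,f]`: `a = dλ`, `b = eλ`, `c = fλ` for some `λ ≠ 0`. -/
def Rel (s t : Octonion × Octonion × Octonion) : Prop :=
  ∃ l : Octonion, l ≠ 0 ∧ s.1 = t.1 * l ∧ s.2.1 = t.2.1 * l ∧ s.2.2 = t.2.2 * l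

/-- Reduced homogeneous coordinates: points of `U₁ ∪ U₂`. -/
abbrev Coords : Type := ↥(U₁ ∪ U₂)

/-- First affine coordinates `(b a⁻¹, c a⁻¹)`. -/
def aff (t : Octonion × Octonion × Octonion) : Octonion × Octonion :=
  (t.2.1 * t.1⁻¹, t.2.2 * t.1⁻¹)

/-- Interchange of the first two homogeneous coordinates. -/
def swapTriple (t : Octonion × Octonion × Octonion) : Octonion × Octonion × Octonion :=
  (t.2.1, t.1, t.2.2)

theorem aff_of_mem_U₁ {t : Octonion × Octonion × Octonion} (ht : t ∈ U₁) :
    aff t = (t.2.1, t.2.2) := by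
  simp only [aff, ht.1, Octonion.inv_one, Octonion.mul_one]

theorem aff_of_mem_U₂ {t : Octonion × Octonion × Octonion} (ht : t ∈ U₂) :
    aff t = (t.1⁻¹, t.2.2 * t.1⁻¹) := by
  simp only [aff, ht.1, Octonion.one_mul]

theorem rel_refl (t : Octonion × Octonion × Octonion) : Rel t t :=
  ⟨1, Octonion.one_ne_zero, (Octonion.mul_one _).symm, (Octonion.mul_one _).symm,
    (Octonion.mul_one _).symm⟩

theorem rel_symm {s t : Octonion × Octonion × Octonion} (h : Rel s t) : Rel t s := by
  obtain ⟨l, hl, h₁, h₂, h₃⟩ := h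
  exact ⟨l⁻¹, Octonion.inv_ne_zero hl, by rw [h₁, Octonion.mul_mul_inv hl],
    by rw [h₂, Octonion.mul_mul_inv hl], by rw [h₃, Octonion.mul_mul_inv hl]⟩

theorem rel_fst {s t : Octonion × Octonion × Octonion} (h : Rel s t) (ht : t.1 ≠ 0) :
    s.1 ≠ 0 := by
  obtain ⟨l, hl, h₁, -, -⟩ := h
  rw [h₁]
  exact Octonion.mul_ne_zero ht hl

theorem eq_of_rel_one {s t : Octonion × Octonion × Octonion} {l : Octonion} (hl : l = 1)
    (h₁ : s.1 = t.1 * l) (h₂ : s.2.1 = t.2.1 * l) (h₃ : s.2.2 = t.2.2 * l) : s = t := by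
  subst hl
  simp only [Octonion.mul_one] at h₁ h₂ h₃
  exact Prod.ext h₁ (Prod.ext h₂ h₃)

theorem eq_of_rel_U₂ {s t : Octonion × Octonion × Octonion} (hs : s ∈ U₂) (ht : t ∈ U₂)
    (h : Rel s t) : s = t := by
  obtain ⟨l, -, h₁, h₂, h₃⟩ := h
  have h4 := h₂
  rw [hs.1, ht.1, Octonion.one_mul] at h4
  exact eq_of_rel_one h4.symm h₁ h₂ h₃

theorem eq_of_rel_U₁ {s t : Octonion × Octonion × Octonion} (hs : s ∈ U₁) (ht : t ∈ U₁)
    (h : Rel s t) : s = t := by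
  obtain ⟨l, -, h₁, h₂, h₃⟩ := h
  have h4 := h₁
  rw [hs.1, ht.1, Octonion.one_mul] at h4
  exact eq_of_rel_one h4.symm h₁ h₂ h₃

theorem aff_eq_of_rel_U₁_U₂ {s t : Octonion × Octonion × Octonion} (hs : s ∈ U₁) (ht : t ∈ U₂)
    (h : Rel s t) : aff s = aff t := by
  obtain ⟨l, hl, h₁, h₂, h₃⟩ := h
  rw [hs.1] at h₁
  rw [ht.1, Octonion.one_mul] at h₂
  have h4 := Octonion.eq_inv_of_mul_eq_one h₁.symm
  rw [aff_of_mem_U₁ hs, aff_of_mem_U₂ ht, h4, Octonion.inv_inv hl, h₂, h₃]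

theorem aff_eq_of_rel {s t : Octonion × Octonion × Octonion} (hs : s ∈ U₁ ∪ U₂)
    (ht : t ∈ U₁ ∪ U₂) (h : Rel s t) : aff s = aff t := by
  rcases hs with hs | hs <;> rcases ht with ht | ht
  · rw [eq_of_rel_U₁ hs ht h]
  · exact aff_eq_of_rel_U₁_U₂ hs ht h
  · exact (aff_eq_of_rel_U₁_U₂ ht hs (rel_symm h)).symm
  · rw [eq_of_rel_U₂ hs ht h]

theorem rel_of_aff_eq_U₂_U₁ {s t : Octonion × Octonion × Octonion} (hs : s ∈ U₂) (ht : t ∈ U₁)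
    (hs₀ : s.1 ≠ 0) (h : aff s = aff t) : Rel s t := by
  rw [aff_of_mem_U₂ hs, aff_of_mem_U₁ ht, Prod.mk.injEq] at h
  refine ⟨s.1, hs₀, ?_, ?_, ?_⟩
  · rw [ht.1, Octonion.one_mul]
  · rw [← h.1, Octonion.inv_mul_self hs₀, hs.1]
  · rw [← h.2, Octonion.mul_inv_mul hs₀]

theorem rel_of_aff_eq {s t : Octonion × Octonion × Octonion} (hs : s ∈ U₁ ∪ U₂)
    (ht : t ∈ U₁ ∪ U₂) (hs₀ : s.1 ≠ 0) (ht₀ : t.1 ≠ 0) (h : aff s = aff t) : Rel s t := by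
  rcases hs with hs | hs <;> rcases ht with ht | ht
  · rw [aff_of_mem_U₁ hs, aff_of_mem_U₁ ht] at h
    have : s = t := Prod.ext (hs.1.trans ht.1.symm) h
    rw [this]
    exact rel_refl t
  · exact rel_symm (rel_of_aff_eq_U₂_U₁ ht hs ht₀ h.symm)
  · exact rel_of_aff_eq_U₂_U₁ hs ht hs₀ h
  · rw [aff_of_mem_U₂ hs, aff_of_mem_U₂ ht, Prod.mk.injEq] at h
    have h₁ : s.1 = t.1 := by rw [← Octonion.inv_inv hs₀, h.1, Octonion.inv_inv ht₀]
    have h₃ : s.2.2 = t.2.2 := by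
      rw [← Octonion.mul_inv_mul hs₀ s.2.2, h.2, h₁, Octonion.mul_inv_mul ht₀]
    have : s = t := Prod.ext h₁ (Prod.ext (hs.1.trans ht.1.symm) h₃)
    rw [this]
    exact rel_refl t

theorem mem_U₂_of_fst_eq_zero {t : Octonion × Octonion × Octonion} (ht : t ∈ U₁ ∪ U₂)
    (h : t.1 = 0) : t ∈ U₂ := by
  rcases ht with ht | ht
  · exact absurd (ht.1.symm.trans h) Octonion.one_ne_zero
  · exact ht

/-- The relation `∼` is an equivalence relation on `U₁ ∪ U₂`. -/
instance setoid : Setoid Coords where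
  r s t := Rel s.1 t.1
  iseqv :=
    { refl := fun t => rel_refl t.1
      symm := fun h => rel_symm h
      trans := by
        intro s t r h h'
        by_cases hs : s.1.1 = 0
        · have ht : t.1.1 = 0 := by
            by_contra ht
            exact rel_fst h ht hs
          rw [eq_of_rel_U₂ (mem_U₂_of_fst_eq_zero s.2 hs) (mem_U₂_of_fst_eq_zero t.2 ht) h]
          exact h'
        · have ht : t.1.1 ≠ 0 := rel_fst (rel_symm h) hs
          have hr : r.1.1 ≠ 0 := rel_fst (rel_symm h') ht
          exact rel_of_aff_eq s.2 r.2 hs hr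
            ((aff_eq_of_rel s.2 t.2 h).trans (aff_eq_of_rel t.2 r.2 h')) }

end OP11

/-- The indefinite octonionic projective plane `𝕆P^(1,1) = (U₁ ∪ U₂)/∼`. -/
def OP11 : Type := Quotient OP11.setoid

namespace OP11

/-- The quotient topology of the subspace topology of `U₁ ∪ U₂ ⊆ 𝕆³`. -/
instance : TopologicalSpace OP11 := inferInstanceAs (TopologicalSpace (Quotient OP11.setoid))

/-- The class `[a, b, c]` of homogeneous coordinates. -/
def toPlane (t : Coords) : OP11 := Quotient.mk OP11.setoid t

theorem isQuotientMap_toPlane : Topology.IsQuotientMap toPlane := isQuotientMap_quotient_mk'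

theorem toPlane_surjective : Function.Surjective toPlane := Quotient.exists_rep

theorem toPlane_eq_iff {s t : Coords} : toPlane s = toPlane t ↔ Rel s.1 t.1 := Quotient.eq

/-- The common image `{(u, v) : 1 + |u|² - |v|² > 0}` of both charts. -/
def domain : Set (Octonion × Octonion) := {y | 0 < 1 + ‖y.1‖ ^ 2 - ‖y.2‖ ^ 2}

theorem isOpen_domain : IsOpen domain :=
  isOpen_lt continuous_const (by fun_prop)

/-- The point `(1, u, v)` of `U₁`. -/
def point₁ (y : domain) : Coords := ⟨(1, y.1.1, y.1.2), Or.inl ⟨rfl, y.2⟩⟩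

theorem aff_mem_domain {t : Octonion × Octonion × Octonion} (ht : t ∈ U₁ ∪ U₂) (h : t.1 ≠ 0) :
    aff t ∈ domain := by
  rcases ht with ht | ht
  · rw [aff_of_mem_U₁ ht]
    exact ht.2
  · rw [aff_of_mem_U₂ ht]
    have hn : 0 < ‖t.1‖ := norm_pos_iff.2 h
    have h2 := ht.2
    have h3 : 1 + ‖t.1⁻¹‖ ^ 2 - ‖t.2.2 * t.1⁻¹‖ ^ 2 =
        (‖t.1‖ ^ 2 + 1 - ‖t.2.2‖ ^ 2) * (‖t.1‖ ^ 2)⁻¹ := by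
      rw [Octonion.norm_mul, Octonion.norm_inv]
      field_simp
    change 0 < 1 + ‖t.1⁻¹‖ ^ 2 - ‖t.2.2 * t.1⁻¹‖ ^ 2
    rw [h3]
    positivity

/-- The open subset `U₁/∼`. -/
def source₁ : Set OP11 := toPlane '' {t | t.1 ∈ U₁}

theorem toPlane_mem_source₁ {t : Coords} : toPlane t ∈ source₁ ↔ t.1.1 ≠ 0 := by
  constructor
  · rintro ⟨s, hs, hst⟩
    refine rel_fst (rel_symm (toPlane_eq_iff.1 hst)) ?_
    rw [hs.1]
    exact Octonion.one_ne_zero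
  · intro h
    have hm := aff_mem_domain t.2 h
    refine ⟨point₁ ⟨aff t.1, hm⟩, ⟨rfl, hm⟩, toPlane_eq_iff.2 ?_⟩
    refine rel_of_aff_eq (point₁ ⟨aff t.1, hm⟩).2 t.2 Octonion.one_ne_zero h ?_
    exact aff_of_mem_U₁ (t := (1, (aff t.1).1, (aff t.1).2)) ⟨rfl, hm⟩

theorem isOpen_source₁ : IsOpen source₁ := by
  rw [← isQuotientMap_toPlane.isOpen_preimage]
  have h : toPlane ⁻¹' source₁ = {t : Coords | t.1.1 ≠ 0} := by
    ext t
    exact toPlane_mem_source₁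
  rw [h]
  exact isOpen_ne_fun (continuous_fst.comp continuous_subtype_val) continuous_const

theorem contDiffAt_aff {t : Octonion × Octonion × Octonion} (ht : t.1 ≠ 0) :
    ContDiffAt ℝ ∞ aff t := by
  have h1 : ContDiffAt ℝ ∞ (fun t : Octonion × Octonion × Octonion => t.1⁻¹) t :=
    (Octonion.contDiffAt_inv ht).comp t contDiffAt_fst
  have h2 : ContDiffAt ℝ ∞ (fun t : Octonion × Octonion × Octonion => t.2) t := contDiffAt_snd
  exact (Octonion.contDiff_mul.contDiffAt.comp t (h2.fst.prodMk h1)).prodMk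
    (Octonion.contDiff_mul.contDiffAt.comp t (h2.snd.prodMk h1))

/-- The point `[1, 0, 0]`. -/
def basePoint : OP11 :=
  toPlane ⟨(1, 0, 0), Or.inl ⟨rfl, by simp⟩⟩

/-- The coordinates of the first chart: `[1, u, v] ↦ (u, v)`. -/
def coord₁ : OP11 → Octonion × Octonion :=
  Quotient.lift (fun t : Coords => aff t.1) fun s t h => aff_eq_of_rel s.2 t.2 h

theorem coord₁_toPlane (t : Coords) : coord₁ (toPlane t) = aff t.1 := rfl

open Classical in
/-- The inverse `(u, v) ↦ [1, u, v]` of the first chart. -/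
def coordInv₁ (y : Octonion × Octonion) : OP11 :=
  if h : y ∈ domain then toPlane (point₁ ⟨y, h⟩) else basePoint

theorem coordInv₁_of_mem {y : Octonion × Octonion} (h : y ∈ domain) :
    coordInv₁ y = toPlane (point₁ ⟨y, h⟩) := dif_pos h

theorem aff_point₁ (y : domain) : aff (point₁ y).1 = y.1 :=
  aff_of_mem_U₁ (t := (1, y.1.1, y.1.2)) ⟨rfl, y.2⟩

theorem coord₁_mem {p : OP11} (hp : p ∈ source₁) : coord₁ p ∈ domain := by
  obtain ⟨t, rfl⟩ := toPlane_surjective p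
  rw [coord₁_toPlane]
  exact aff_mem_domain t.2 (toPlane_mem_source₁.1 hp)

theorem coordInv₁_mem {y : Octonion × Octonion} (hy : y ∈ domain) : coordInv₁ y ∈ source₁ := by
  rw [coordInv₁_of_mem hy, toPlane_mem_source₁]
  exact Octonion.one_ne_zero

theorem coordInv₁_coord₁ {p : OP11} (hp : p ∈ source₁) : coordInv₁ (coord₁ p) = p := by
  obtain ⟨t, rfl⟩ := toPlane_surjective p
  have h := toPlane_mem_source₁.1 hp
  have hm := aff_mem_domain t.2 h
  rw [coord₁_toPlane, coordInv₁_of_mem hm, toPlane_eq_iff]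
  exact rel_of_aff_eq (point₁ ⟨aff t.1, hm⟩).2 t.2 Octonion.one_ne_zero h (aff_point₁ _)

theorem coord₁_coordInv₁ {y : Octonion × Octonion} (hy : y ∈ domain) :
    coord₁ (coordInv₁ y) = y := by
  rw [coordInv₁_of_mem hy, coord₁_toPlane, aff_point₁]

theorem continuousOn_coord₁ : ContinuousOn coord₁ source₁ := by
  rw [isQuotientMap_toPlane.continuousOn_isOpen_iff isOpen_source₁]
  intro t ht
  have h : ContinuousAt (fun t : Coords => aff t.1) t :=
    ContinuousAt.comp (g := aff) (f := fun t : Coords => t.1)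
      (contDiffAt_aff (toPlane_mem_source₁.1 ht)).continuousAt continuousAt_subtype_val
  exact h.continuousWithinAt

theorem continuous_point₁ : Continuous point₁ := by
  refine Continuous.subtype_mk ?_ _
  exact continuous_const.prodMk continuous_subtype_val

theorem continuousOn_coordInv₁ : ContinuousOn coordInv₁ domain := by
  rw [continuousOn_iff_continuous_domRestrict]
  have h : domain.domRestrict coordInv₁ = fun y => toPlane (point₁ y) := by
    ext y
    rw [Set.domRestrict_apply, coordInv₁_of_mem y.2]
  rw [h]
  exact isQuotientMap_toPlane.continuous.comp continuous_point₁

/-- The first chart `[1, u, v] ↦ (u, v)`, defined on `U₁/∼`. -/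
def chart₁ : OpenPartialHomeomorph OP11 (Octonion × Octonion) where
  toFun := coord₁
  invFun := coordInv₁
  source := source₁
  target := domain
  map_source' _ hp := coord₁_mem hp
  map_target' _ hy := coordInv₁_mem hy
  left_inv' _ hp := coordInv₁_coord₁ hp
  right_inv' _ hy := coord₁_coordInv₁ hy
  open_source := isOpen_source₁
  open_target := isOpen_domain
  continuousOn_toFun := continuousOn_coord₁
  continuousOn_invFun := continuousOn_coordInv₁

theorem swapTriple_mem {t : Octonion × Octonion × Octonion} (ht : t ∈ U₁ ∪ U₂) :
    swapTriple t ∈ U₁ ∪ U₂ := by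
  rcases ht with ht | ht
  · refine Or.inr ⟨ht.1, ?_⟩
    have := ht.2
    simp only [swapTriple]
    linarith
  · refine Or.inl ⟨ht.1, ?_⟩
    have := ht.2
    simp only [swapTriple]
    linarith

/-- The map `[a, b, c] ↦ [b, a, c]`. -/
def swapFun : OP11 → OP11 :=
  Quotient.lift (fun t : Coords => toPlane ⟨swapTriple t.1, swapTriple_mem t.2⟩) fun _ _ h => by
    obtain ⟨l, hl, h₁, h₂, h₃⟩ := h
    exact toPlane_eq_iff.2 ⟨l, hl, h₂, h₁, h₃⟩

theorem swapFun_toPlane (t : Coords) :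
    swapFun (toPlane t) = toPlane ⟨swapTriple t.1, swapTriple_mem t.2⟩ := rfl

theorem swapFun_swapFun (p : OP11) : swapFun (swapFun p) = p := by
  obtain ⟨t, rfl⟩ := toPlane_surjective p
  rfl

theorem continuous_swapFun : Continuous swapFun := by
  rw [isQuotientMap_toPlane.continuous_iff]
  refine isQuotientMap_toPlane.continuous.comp (Continuous.subtype_mk ?_ _)
  unfold swapTriple
  fun_prop

/-- The map `[a, b, c] ↦ [b, a, c]` as a homeomorphism. -/
def swap : OP11 ≃ₜ OP11 where
  toFun := swapFun
  invFun := swapFun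
  left_inv := swapFun_swapFun
  right_inv := swapFun_swapFun
  continuous_toFun := continuous_swapFun
  continuous_invFun := continuous_swapFun

/-- The second chart `[u, 1, v] ↦ (u, v)`, defined on `U₂/∼`. -/
def chart₂ : OpenPartialHomeomorph OP11 (Octonion × Octonion) :=
  swap.transOpenPartialHomeomorph chart₁

theorem chart₁_apply (u v : Octonion) (h : (1, u, v) ∈ U₁) :
    chart₁ (toPlane ⟨(1, u, v), Or.inl h⟩) = (u, v) := aff_of_mem_U₁ h

theorem chart₂_apply (u v : Octonion) (h : (u, 1, v) ∈ U₂) :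
    chart₂ (toPlane ⟨(u, 1, v), Or.inr h⟩) = (u, v) :=
  aff_of_mem_U₁ (t := (1, u, v)) ⟨rfl, by have := h.2; simp only at this ⊢; linarith⟩

theorem mem_chart₂_source {t : Coords} : toPlane t ∈ chart₂.source ↔ t.1.2.1 ≠ 0 :=
  toPlane_mem_source₁ (t := ⟨swapTriple t.1, swapTriple_mem t.2⟩)

theorem chart₁_source : chart₁.source = toPlane '' {t | t.1 ∈ U₁} := rfl

theorem chart₂_source : chart₂.source = toPlane '' {t | t.1 ∈ U₂} := by
  ext p
  constructor
  · rintro ⟨s, hs, hsp⟩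
    refine ⟨⟨swapTriple s.1, swapTriple_mem s.2⟩, ⟨hs.1, ?_⟩, ?_⟩
    · have := hs.2
      simp only [swapTriple]
      linarith
    · have h2 : swapFun (toPlane s) = swapFun (swapFun p) := congrArg swapFun hsp
      rw [swapFun_swapFun] at h2
      exact h2
  · rintro ⟨t, ht, rfl⟩
    rw [mem_chart₂_source, ht.1]
    exact Octonion.one_ne_zero

open Classical in
instance : ChartedSpace (Octonion × Octonion) OP11 where
  atlas := {chart₁, chart₂}
  chartAt p := if p ∈ chart₁.source then chart₁ else chart₂
  mem_chart_source p := by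
    by_cases h : p ∈ chart₁.source
    · rw [if_pos h]
      exact h
    · rw [if_neg h]
      obtain ⟨t, rfl⟩ := toPlane_surjective p
      have h0 : t.1.1 = 0 := by
        by_contra h0
        exact h (toPlane_mem_source₁.2 h0)
      rw [mem_chart₂_source, (mem_U₂_of_fst_eq_zero t.2 h0).1]
      exact Octonion.one_ne_zero
  chart_mem_atlas p := by
    by_cases h : p ∈ chart₁.source
    · rw [if_pos h]
      exact Or.inl rfl
    · rw [if_neg h]
      exact Or.inr rfl

theorem chartAt_basePoint : chartAt (Octonion × Octonion) basePoint = chart₁ :=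
  if_pos (toPlane_mem_source₁.2 Octonion.one_ne_zero)

/-- The transition map `(u, v) ↦ (u⁻¹, v u⁻¹)` between the two charts. -/
def transition (y : Octonion × Octonion) : Octonion × Octonion := (y.1⁻¹, y.2 * y.1⁻¹)

theorem contDiffAt_transition {y : Octonion × Octonion} (hy : y.1 ≠ 0) :
    ContDiffAt ℝ ∞ transition y := by
  have h1 : ContDiffAt ℝ ∞ (fun y : Octonion × Octonion => y.1⁻¹) y :=
    (Octonion.contDiffAt_inv hy).comp y contDiffAt_fst
  exact h1.prodMk (Octonion.contDiff_mul.contDiffAt.comp y (contDiffAt_snd.prodMk h1))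

theorem swapFun_coordInv₁ {y : Octonion × Octonion} (hy : y ∈ domain) :
    ∃ h : (y.1, 1, y.2) ∈ U₂, swapFun (coordInv₁ y) = toPlane ⟨(y.1, 1, y.2), Or.inr h⟩ := by
  have h : 0 < 1 + ‖y.1‖ ^ 2 - ‖y.2‖ ^ 2 := hy
  refine ⟨⟨rfl, ?_⟩, ?_⟩
  · simp only
    linarith
  · rw [coordInv₁_of_mem hy]
    rfl

theorem coord₁_swapFun_coordInv₁ {y : Octonion × Octonion} (hy : y ∈ domain) :
    coord₁ (swapFun (coordInv₁ y)) = transition y := by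
  obtain ⟨h, h'⟩ := swapFun_coordInv₁ hy
  rw [h', coord₁_toPlane]
  exact aff_of_mem_U₂ h

theorem fst_ne_zero_of_swapFun_mem {y : Octonion × Octonion} (hy : y ∈ domain)
    (h : swapFun (coordInv₁ y) ∈ source₁) : y.1 ≠ 0 := by
  obtain ⟨h', h''⟩ := swapFun_coordInv₁ hy
  rw [h'', toPlane_mem_source₁] at h
  exact h

theorem contDiffOn_transition {f : Octonion × Octonion → Octonion × Octonion}
    {s : Set (Octonion × Octonion)} (hs : ∀ y ∈ s, y.1 ≠ 0) (hf : ∀ y ∈ s, f y = transition y) :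
    ContDiffOn ℝ ∞ f s := by
  have h : ContDiffOn ℝ ∞ transition s := fun y hy =>
    (contDiffAt_transition (hs y hy)).contDiffWithinAt
  exact h.congr hf

instance : IsManifold 𝓘(ℝ, Octonion × Octonion) ∞ OP11 := by
  apply isManifold_of_contDiffOn
  have hid : ∀ e : OpenPartialHomeomorph OP11 (Octonion × Octonion),
      ContDiffOn ℝ ∞ (e.symm ≫ₕ e) (e.symm ≫ₕ e).source := fun e =>
    contDiffOn_id.congr fun y hy => e.right_inv hy.1
  intro e e' he he'
  change e ∈ ({chart₁, chart₂} : Set _) at he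
  change e' ∈ ({chart₁, chart₂} : Set _) at he'
  simp only [modelWithCornersSelf_coe, modelWithCornersSelf_coe_symm, Function.id_comp,
    Function.comp_id, Set.preimage_id, Set.range_id, Set.inter_univ]
  rcases he with rfl | rfl <;> rcases he' with rfl | rfl
  · exact hid _
  · exact contDiffOn_transition (fun y hy => fst_ne_zero_of_swapFun_mem hy.1 hy.2)
      (fun y hy => coord₁_swapFun_coordInv₁ hy.1)
  · exact contDiffOn_transition (fun y hy => fst_ne_zero_of_swapFun_mem hy.1 hy.2)
      (fun y hy => coord₁_swapFun_coordInv₁ hy.1)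
  · exact hid _

/-- The polarization of
`ds² = (|du|²(1 - |v|²) - |dv|²(1 + |u|²) + 2 Re[(u v̄)(dv dū)]) / (1 + |u|² - |v|²)²`
at the point `y = (u, v)`. -/
def coordMetricFun (y w z : Octonion × Octonion) : ℝ :=
  (inner ℝ w.1 z.1 * (1 - ‖y.2‖ ^ 2) - inner ℝ w.2 z.2 * (1 + ‖y.1‖ ^ 2)
    + (Octonion.re ((y.1 * star y.2) * (w.2 * star z.1))
      + Octonion.re ((y.1 * star y.2) * (z.2 * star w.1))))
    / (1 + ‖y.1‖ ^ 2 - ‖y.2‖ ^ 2) ^ 2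

/-- The expression of the metric in either chart, as a continuous bilinear form. -/
def coordMetric (y : Octonion × Octonion) :
    (Octonion × Octonion) →L[ℝ] (Octonion × Octonion) →L[ℝ] ℝ :=
  (LinearMap.mk₂ ℝ (coordMetricFun y)
    (fun w w' z => by
      simp only [coordMetricFun, Prod.fst_add, Prod.snd_add, inner_add_left, Octonion.add_mul,
        Octonion.star_add, Octonion.mul_add, Octonion.re_add]
      ring)
    (fun r w z => by
      simp only [coordMetricFun, Prod.smul_fst, Prod.smul_snd, real_inner_smul_left,
        Octonion.smul_mul, Octonion.star_smul, Octonion.mul_smul, Octonion.re_smul, smul_eq_mul]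
      ring)
    (fun w z z' => by
      simp only [coordMetricFun, Prod.fst_add, Prod.snd_add, inner_add_right, Octonion.add_mul,
        Octonion.star_add, Octonion.mul_add, Octonion.re_add]
      ring)
    (fun r w z => by
      simp only [coordMetricFun, Prod.smul_fst, Prod.smul_snd, real_inner_smul_right,
        Octonion.smul_mul, Octonion.star_smul, Octonion.mul_smul, Octonion.re_smul, smul_eq_mul]
      ring)).toContinuousBilinearMap

theorem coordMetric_apply (y w z : Octonion × Octonion) :
    coordMetric y w z = coordMetricFun y w z := rfl

/-- The metric of `𝕆P^(1,1)`, given at `p` by `coordMetric` in the preferred chart at `p`. -/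
def metric : SemiRiemannian.BilinField (Octonion × Octonion) OP11 :=
  fun p => coordMetric (chartAt (Octonion × Octonion) p p)

/-- The identification of the tangent space at `[1, 0, 0]` with pairs of octonions: the differential
of the first chart `[1, u, v] ↦ (u, v)`. -/
def tangentCoord : TangentSpace 𝓘(ℝ, Octonion × Octonion) basePoint →L[ℝ] Octonion × Octonion :=
  mfderiv 𝓘(ℝ, Octonion × Octonion) 𝓘(ℝ, Octonion × Octonion) chart₁ basePoint

end OP11

end

/-! The plane is homogeneous, so everything can be checked at the origin of one chart, where the
Jacobi operator is an explicit 2 × 2 octonionic matrix.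

Homogeneity. Sending (u, v) to the Hermitian matrix x x* / (1 + |u|² - |v|²), x = (1, u, v),
realizes g as half the pullback of an indefinite quadratic form (`coordMetric_self`). Hence a map of
the affine plane that corresponds to a linear map of matrices preserving this form is an isometry
(`isLocalIsometryAt_of_veronese`). Because 𝕆 is not associative, only some maps qualify. Real
orthogonal maps of the first two homogeneous coordinates and real boosts of the first and third do,
because two octonions generate an associative algebra; the twists (u, v) ↦ (au, āv) with |a| = 1 do,
by the middle Moufang identity. Together they carry every point to 0 (`exists_isLocalIsometryAt`).
The transition between the charts is one of the orthogonal maps, so the two chart expressions agree.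
Local isometries preserve curvature (`fderiv_curvature`), so every tangent space, with its metric
and Jacobi operators, is a copy of the one at 0 (`exists_isModel`).

The origin. The first derivatives of the metric vanish at 0, so the second derivatives give 𝒥_v x =
4(εx - g(v,x)v) + 3Nx, where ε = g(v,v) and N = `defect v`. For v = (a, b) the rows of N are (|b|²,
-a b̄) and (b ā, -|a|²), acting by left multiplication. From (a b̄)((b ā)x) = |a|²|b|²x follows N² =
-εN, and the image of N is orthogonal to v. If ε ≠ 0, the space is therefore ker N ⊕ im N, with ker
N the octonionic line through v. On ker N ∩ v^⊥ the operator is 4ε, and on im N it is 4ε - 3ε = ε.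
Condition II says that a nonzero vector determines the line containing it. Condition III says that
(a b̄)d = |a|²c together with (b ā)c = |b|²d is a symmetric relation between (a, b) and (c, d). -/

namespace Octonion

/-! ### Octonion identities: adjoints of multiplications, alternativity, Moufang -/

theorem star_star' (x : Octonion) : star (star x) = x := by
  ext <;> simp

theorem star_mul' (x y : Octonion) : star (x * y) = star y * star x := by
  ext <;> simp

theorem inner_mul_left (x y z : Octonion) : inner ℝ (x * y) z = inner ℝ y (star x * z) := by
  simp [inner_coord]
  ring

theorem inner_mul_right (x y z : Octonion) : inner ℝ (x * y) z = inner ℝ x (z * star y) := by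
  simp [inner_coord]
  ring

theorem inner_star_star (x y : Octonion) : inner ℝ (star x) (star y) = inner ℝ x y := by
  simp [inner_coord]

theorem re_mul_mul_star (x y z : Octonion) : re (x * (y * star z)) = inner ℝ (x * y) z := by
  simp [inner_coord, re]
  ring

theorem star_mul_mul (x y : Octonion) : star x * (x * y) = ‖x‖ ^ 2 • y := by
  ext <;> simp [norm_sq_coord] <;> ring

theorem mul_star_mul' (x y : Octonion) : x * (star x * y) = ‖x‖ ^ 2 • y := by
  ext <;> simp [norm_sq_coord] <;> ring

/-- Polarization of (x ȳ) y = |y|² x. It replaces associativity wherever two right factors have to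
be exchanged. -/
theorem mul_star_mul_add (x y z : Octonion) :
    x * star y * z + x * star z * y = (2 * inner ℝ y z) • x := by
  ext <;> simp [inner_coord] <;> ring

/-- The full polarization of |xy|² = |x|²|y|², obtained by pairing `mul_star_mul_add` with a vector.
-/
theorem inner_mul_mul_add (x y z w : Octonion) :
    inner ℝ (x * y) (z * w) + inner ℝ (x * w) (z * y) = 2 * inner ℝ y w * inner ℝ x z := by
  have h := mul_star_mul_add x (star y) (star w)
  rw [star_star', star_star', inner_star_star] at h
  have h' := congrArg (fun t => inner ℝ t z) h
  simp only [inner_add_left, real_inner_smul_left] at h'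
  rw [← h', inner_mul_right (x * y), inner_mul_right (x * w), star_star', star_star']

/-- The middle Moufang identity, with the right-hand side `a(xy)a` written out. -/
theorem moufang (a x y : Octonion) :
    (a * x) * (y * a) = (2 * inner ℝ a (star (x * y))) • a - ‖a‖ ^ 2 • star (x * y) := by
  -- Pairing with z moves the factor y a to the other side. The exchange law then brings in a (ā ȳ),
  -- which alternativity collapses to |a|² ȳ.
  refine ext_inner_right ℝ fun z => ?_
  have h := inner_mul_mul_add a x z (star (y * a))
  have h1 : inner ℝ x (star (y * a)) = inner ℝ a (star (x * y)) := by
    rw [star_mul', star_mul', ← inner_mul_left, inner_mul_right]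
  have h2 : inner ℝ (star y * star x) z = inner ℝ (star y) (z * x) := by
    rw [inner_mul_right, star_star']
  rw [inner_mul_right, eq_sub_of_add_eq h, h1, star_mul' y a, mul_star_mul', inner_sub_left,
    real_inner_smul_left, real_inner_smul_left, real_inner_smul_left, star_mul' x y, h2]

end Octonion

/-! ### Christoffel symbols, curvature and local isometries in coordinates -/

namespace SemiRiemannian

variable {E : Type*} [NormedAddCommGroup E] [NormedSpace ℝ E]

/-- `G` is a semi-Riemannian metric on the open subset `U` of a vector space. -/
structure IsMetricOn (G : E → E →L[ℝ] E →L[ℝ] ℝ) (U : Set E) : Prop where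
  isOpen : IsOpen U
  symm : ∀ p ∈ U, ∀ v w, G p v w = G p w v
  nondegenerate : ∀ p ∈ U, ∀ v, (∀ w, G p v w = 0) → v = 0
  smooth : ContDiffOn ℝ ∞ G U

namespace IsMetricOn

variable {G : E → E →L[ℝ] E →L[ℝ] ℝ} {U : Set E}

theorem contDiffAt (hG : IsMetricOn G U) {p : E} (hp : p ∈ U) : ContDiffAt ℝ ∞ G p :=
  hG.smooth.contDiffAt (hG.isOpen.mem_nhds hp)

theorem eventually_mem (hG : IsMetricOn G U) {p : E} (hp : p ∈ U) : ∀ᶠ q in nhds p, q ∈ U :=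
  hG.isOpen.mem_nhds hp

theorem contDiffAt_christoffelLower (hG : IsMetricOn G U) {p : E} (hp : p ∈ U) :
    ContDiffAt ℝ ∞ (christoffelLower G) p := by
  have h : ContDiffAt ℝ ∞ (fderiv ℝ G) p := (hG.contDiffAt hp).fderiv_right (by simp)
  have hf : ContDiffAt ℝ ∞ (fun q => (fderiv ℝ G q).flip) p :=
    (ContinuousLinearMap.flipₗᵢ ℝ E E (E →L[ℝ] ℝ)).contDiff.contDiffAt.comp p h
  exact (contDiffAt_const (c := (1 / 2 : ℝ))).smul ((h.add hf).sub (contDiffAt_const.clm_comp hf))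

variable [FiniteDimensional ℝ E]

/-- `ContinuousLinearMap.inverse` is zero on non-invertible maps. In finite dimension nondegeneracy
makes lowering an index invertible, so raising it in `christoffel` is the true inverse. -/
theorem exists_equiv (hG : IsMetricOn G U) {p : E} (hp : p ∈ U) :
    ∃ e : E ≃L[ℝ] (E →L[ℝ] ℝ), (e : E →L[ℝ] E →L[ℝ] ℝ) = G p := by
  have hinj : Function.Injective (G p : E →ₗ[ℝ] E →L[ℝ] ℝ) := by
    rw [← LinearMap.ker_eq_bot, LinearMap.ker_eq_bot']
    intro v hv
    exact hG.nondegenerate p hp v fun w => by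
      change (G p : E →ₗ[ℝ] E →L[ℝ] ℝ) v w = 0
      rw [hv]
      rfl
  have hfin : Module.finrank ℝ E = Module.finrank ℝ (E →L[ℝ] ℝ) := by
    rw [← (LinearMap.toContinuousLinearMap : (E →ₗ[ℝ] ℝ) ≃ₗ[ℝ] E →L[ℝ] ℝ).finrank_eq]
    exact (Subspace.dual_finrank_eq).symm
  refine ⟨(LinearEquiv.ofInjectiveOfFinrankEq _ hinj hfin).toContinuousLinearEquiv, ?_⟩
  ext v w
  rfl

theorem apply_inverse (hG : IsMetricOn G U) {p : E} (hp : p ∈ U) (l : E →L[ℝ] ℝ) :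
    G p ((G p).inverse l) = l := by
  obtain ⟨e, he⟩ := hG.exists_equiv hp
  rw [← he, ContinuousLinearMap.inverse_equiv]
  exact e.apply_symm_apply l

theorem apply_christoffel (hG : IsMetricOn G U) {p : E} (hp : p ∈ U) (v w z : E) :
    G p (christoffel G p v w) z = christoffelLower G p v w z := by
  rw [christoffel_apply, hG.apply_inverse hp]

theorem contDiffAt_inverse (hG : IsMetricOn G U) {p : E} (hp : p ∈ U) :
    ContDiffAt ℝ ∞ (fun q => (G q).inverse) p := by
  have := FiniteDimensional.complete ℝ E
  obtain ⟨e, he⟩ := hG.exists_equiv hp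
  have h : ContDiffAt ℝ ∞ ContinuousLinearMap.inverse (G p) := by
    rw [← he]
    exact contDiffAt_map_inverse e
  exact h.comp p (hG.contDiffAt hp)

theorem contDiffAt_christoffel (hG : IsMetricOn G U) {p : E} (hp : p ∈ U) :
    ContDiffAt ℝ ∞ (christoffel G) p :=
  ((ContinuousLinearMap.compL ℝ E (E →L[ℝ] ℝ) E).contDiff.contDiffAt.comp p
    (hG.contDiffAt_inverse hp)).clm_comp (hG.contDiffAt_christoffelLower hp)

end IsMetricOn

/-- `φ` is smooth at `y` and preserves the metric `G` near `y`. -/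
structure IsLocalIsometryAt (G : E → E →L[ℝ] E →L[ℝ] ℝ) (φ : E → E) (y : E) : Prop where
  smooth : ContDiffAt ℝ 3 φ y
  isometric : ∀ᶠ z in nhds y, ∀ v w, G z v w = G (φ z) (fderiv ℝ φ z v) (fderiv ℝ φ z w)

namespace IsLocalIsometryAt

variable {G : E → E →L[ℝ] E →L[ℝ] ℝ} {U : Set E} {φ ψ : E → E} {y : E}

theorem eventually (h : IsLocalIsometryAt G φ y) : ∀ᶠ z in nhds y, IsLocalIsometryAt G φ z := by
  filter_upwards [h.smooth.eventually (by simp), h.isometric.eventually_nhds] with z h1 h2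
  exact ⟨h1, h2⟩

theorem differentiableAt (h : IsLocalIsometryAt G φ y) : DifferentiableAt ℝ φ y :=
  h.smooth.differentiableAt (by simp)

theorem contDiffAt_fderiv (h : IsLocalIsometryAt G φ y) : ContDiffAt ℝ 2 (fderiv ℝ φ) y :=
  h.smooth.fderiv_right (by norm_num)

theorem contDiffAt_fderiv_fderiv (h : IsLocalIsometryAt G φ y) :
    ContDiffAt ℝ 1 (fderiv ℝ (fderiv ℝ φ)) y :=
  h.contDiffAt_fderiv.fderiv_right (by norm_num)

theorem comp (hψ : IsLocalIsometryAt G ψ (φ y)) (hφ : IsLocalIsometryAt G φ y) :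
    IsLocalIsometryAt G (ψ ∘ φ) y where
  smooth := hψ.smooth.comp y hφ.smooth
  isometric := by
    have hc := hφ.smooth.continuousAt
    filter_upwards [hφ.eventually, hc.eventually hψ.eventually] with z h1 h2 v w
    rw [h1.isometric.self_of_nhds, h2.isometric.self_of_nhds,
      fderiv_comp z h2.differentiableAt h1.differentiableAt]
    rfl

theorem fderiv_injective (hG : IsMetricOn G U) (hy : y ∈ U) (h : IsLocalIsometryAt G φ y) :
    Function.Injective (fderiv ℝ φ y) := by
  rw [injective_iff_map_eq_zero]
  intro v hv
  refine hG.nondegenerate y hy v fun w => ?_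
  rw [h.isometric.self_of_nhds, hv, map_zero, zero_apply]

/-- The derivative of the isometry equation. The two terms with D²φ are what makes the Christoffel
symbols transform inhomogeneously. -/
theorem fderiv_metric (hG : IsMetricOn G U) (hy : y ∈ U) (hφ : φ y ∈ U)
    (h : IsLocalIsometryAt G φ y) (x v w : E) :
    fderiv ℝ G y x v w =
      fderiv ℝ G (φ y) (fderiv ℝ φ y x) (fderiv ℝ φ y v) (fderiv ℝ φ y w)
      + G (φ y) (fderiv ℝ (fderiv ℝ φ) y x v) (fderiv ℝ φ y w)
      + G (φ y) (fderiv ℝ φ y v) (fderiv ℝ (fderiv ℝ φ) y x w) := by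
  have hGy := ((hG.contDiffAt hy).differentiableAt (by simp)).hasFDerivAt
  have hGφ := ((hG.contDiffAt hφ).differentiableAt (by simp)).hasFDerivAt
  have hd := (h.contDiffAt_fderiv.differentiableAt (by simp)).hasFDerivAt
  have h1 := (hGy.clm_apply (hasFDerivAt_const v y)).clm_apply (hasFDerivAt_const w y)
  have h2 := ((hGφ.comp y h.differentiableAt.hasFDerivAt).clm_apply
    (hd.clm_apply (hasFDerivAt_const v y))).clm_apply (hd.clm_apply (hasFDerivAt_const w y))
  have h3 := h2.congr_of_eventuallyEq (h.isometric.mono fun z hz => hz v w)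
  have h4 := congrArg (fun l => l x) (h1.unique h3)
  simp at h4
  rw [h4]
  ring

variable [FiniteDimensional ℝ E]

theorem fderiv_surjective (hG : IsMetricOn G U) (hy : y ∈ U) (h : IsLocalIsometryAt G φ y) :
    Function.Surjective (fderiv ℝ φ y) :=
  (LinearMap.injective_iff_surjective (f := (fderiv ℝ φ y).toLinearMap)).1
    (h.fderiv_injective hG hy)

/-- The transformation law of the Christoffel symbols. -/
theorem fderiv_christoffel (hG : IsMetricOn G U) (hy : y ∈ U) (hφ : φ y ∈ U)
    (h : IsLocalIsometryAt G φ y) (v w : E) :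
    fderiv ℝ φ y (christoffel G y v w) =
      christoffel G (φ y) (fderiv ℝ φ y v) (fderiv ℝ φ y w) + fderiv ℝ (fderiv ℝ φ) y v w := by
  have hsymm : ∀ v w, fderiv ℝ (fderiv ℝ φ) y v w = fderiv ℝ (fderiv ℝ φ) y w v :=
    h.smooth.isSymmSndFDerivAt (by simp [minSmoothness_of_isRCLikeNormedField]; norm_num)
  -- It suffices to pair with vectors Dφ z, as Dφ is onto. The pairings are Koszul expressions, and
  -- the symmetry of D²φ leaves a single Hessian term.
  rw [← sub_eq_zero]
  refine hG.nondegenerate _ hφ _ fun z => ?_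
  obtain ⟨z, rfl⟩ := h.fderiv_surjective hG hy z
  simp only [map_sub, map_add, sub_apply, add_apply]
  rw [← h.isometric.self_of_nhds, hG.apply_christoffel hy, hG.apply_christoffel hφ,
    christoffelLower_apply, christoffelLower_apply, h.fderiv_metric hG hy hφ,
    h.fderiv_metric hG hy hφ, h.fderiv_metric hG hy hφ, hsymm w v, hsymm z v, hsymm z w,
    hG.symm _ hφ (fderiv ℝ (fderiv ℝ φ) y v z)]
  ring

/-- Local isometries preserve the curvature. -/
theorem fderiv_curvature (hG : IsMetricOn G U) (hy : y ∈ U) (hφ : φ y ∈ U)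
    (h : IsLocalIsometryAt G φ y) (x v z : E) :
    fderiv ℝ φ y (curvature G y x v z) =
      curvature G (φ y) (fderiv ℝ φ y x) (fderiv ℝ φ y v) (fderiv ℝ φ y z) := by
  have hsymm : ∀ v w, fderiv ℝ (fderiv ℝ φ) y v w = fderiv ℝ (fderiv ℝ φ) y w v :=
    h.smooth.isSymmSndFDerivAt (by simp [minSmoothness_of_isRCLikeNormedField]; norm_num)
  have hsymm' : ∀ v w, fderiv ℝ (fderiv ℝ (fderiv ℝ φ)) y v w =
      fderiv ℝ (fderiv ℝ (fderiv ℝ φ)) y w v :=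
    h.contDiffAt_fderiv.isSymmSndFDerivAt (by simp [minSmoothness_of_isRCLikeNormedField])
  -- The transformation law of the Christoffel symbols, differentiated in the direction v.
  -- Antisymmetrizing in x and v removes D³φ and the term with D²φ(v, x); the other Hessian terms
  -- cancel against those from the quadratic part of the curvature.
  have key : ∀ x v z, fderiv ℝ φ y (fderiv ℝ (christoffel G) y v x z) =
      fderiv ℝ (christoffel G) (φ y) (fderiv ℝ φ y v) (fderiv ℝ φ y x) (fderiv ℝ φ y z)
      + christoffel G (φ y) (fderiv ℝ (fderiv ℝ φ) y v x) (fderiv ℝ φ y z)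
      + christoffel G (φ y) (fderiv ℝ φ y x) (fderiv ℝ (fderiv ℝ φ) y v z)
      + fderiv ℝ (fderiv ℝ (fderiv ℝ φ)) y v x z
      - fderiv ℝ (fderiv ℝ φ) y v (christoffel G y x z) := by
    intro x v z
    have hΓy := ((hG.contDiffAt_christoffel hy).differentiableAt (by simp)).hasFDerivAt
    have hΓφ := ((hG.contDiffAt_christoffel hφ).differentiableAt (by simp)).hasFDerivAt
    have hd := (h.contDiffAt_fderiv.differentiableAt (by simp)).hasFDerivAt
    have hdd := (h.contDiffAt_fderiv_fderiv.differentiableAt (by simp)).hasFDerivAt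
    have h1 := hd.clm_apply ((hΓy.clm_apply (hasFDerivAt_const x y)).clm_apply
      (hasFDerivAt_const z y))
    have h2 := (((hΓφ.comp y h.differentiableAt.hasFDerivAt).clm_apply
      (hd.clm_apply (hasFDerivAt_const x y))).clm_apply (hd.clm_apply (hasFDerivAt_const z y))).add
      ((hdd.clm_apply (hasFDerivAt_const x y)).clm_apply (hasFDerivAt_const z y))
    have h3 := h2.congr_of_eventuallyEq (f₁ := fun q => fderiv ℝ φ q (christoffel G q x z)) (by
      filter_upwards [h.eventually, hG.eventually_mem hy,
        h.smooth.continuousAt.eventually (hG.eventually_mem hφ)] with q h4 h5 h6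
      exact h4.fderiv_christoffel hG h5 h6 x z)
    have h4 := congrArg (fun l => l v) (h1.unique h3)
    simp at h4
    rw [eq_sub_iff_add_eq, h4]
    abel
  simp only [curvature, map_add, map_sub, key, h.fderiv_christoffel hG hy hφ, hsymm x v,
    hsymm' x v]
  abel

end IsLocalIsometryAt
end SemiRiemannian

/-! ### Associativity in the algebra generated by x and one more octonion -/

namespace Octonion

theorem mul_star_self (x : Octonion) : x * star x = ‖x‖ ^ 2 • (1 : Octonion) := by
  rw [← mul_mul_star, one_mul]

theorem star_one' : star (1 : Octonion) = 1 := by ext <;> simp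

theorem inner_one_right (x : Octonion) : inner ℝ x 1 = re x := by
  rw [inner_eq_re, star_one', mul_one]

theorem star_eq (x : Octonion) : star x = (2 * re x) • (1 : Octonion) + (-1 : ℝ) • x := by
  ext <;> simp [re]
  ring

theorem norm_sq_affine (a b : ℝ) (x : Octonion) :
    ‖a • (1 : Octonion) + b • x‖ ^ 2 = a ^ 2 + 2 * a * b * re x + b ^ 2 * ‖x‖ ^ 2 := by
  rw [norm_add_sq_real, norm_smul, norm_smul, real_inner_smul_left, real_inner_smul_right,
    real_inner_comm, inner_one_right, norm_one, mul_pow, mul_pow, Real.norm_eq_abs,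
    Real.norm_eq_abs, sq_abs, sq_abs]
  ring

theorem mul_mul_self (x y : Octonion) :
    x * (x * y) = (2 * re x) • (x * y) + (-‖x‖ ^ 2) • y := by
  have h := star_mul_mul x y
  rw [star_eq, add_mul, smul_mul, smul_mul, one_mul] at h
  rw [neg_smul, ← h]
  module

/-- An instance of Artin's theorem: (q p̄)(p y) = |p|² q y for p, q in ℝ1 + ℝx. This lets real
linear substitutions of homogeneous coordinates act linearly on x x*. -/
theorem affine_mul_star_mul (a b c d : ℝ) (x y : Octonion) :
    ((c • (1 : Octonion) + d • x) * star (a • (1 : Octonion) + b • x)) *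
      ((a • (1 : Octonion) + b • x) * y) =
    ‖a • (1 : Octonion) + b • x‖ ^ 2 • ((c • (1 : Octonion) + d • x) * y) := by
  rw [norm_sq_affine]
  simp only [star_add, star_smul, star_one', add_mul, mul_add, smul_mul, mul_smul, one_mul,
    mul_one, mul_star_self, star_mul_mul, mul_mul_self]
  rw [star_eq x, add_mul, smul_mul, smul_mul, one_mul]
  module

theorem mul_star_mul_affine (a b c d : ℝ) (x y : Octonion) :
    (y * star (a • (1 : Octonion) + b • x)) *
      ((a • (1 : Octonion) + b • x) * star (c • (1 : Octonion) + d • x)) =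
    ‖a • (1 : Octonion) + b • x‖ ^ 2 • (y * star (c • (1 : Octonion) + d • x)) := by
  have h := congrArg star (affine_mul_star_mul a b c d x (star y))
  simpa only [star_mul', star_star', star_smul] using h

end Octonion

/-! ### Differentiation of octonion-valued expressions -/

theorem ContDiffAt.octonion_mul {E : Type*} [NormedAddCommGroup E] [NormedSpace ℝ E]
    {n : WithTop ℕ∞} {f g : E → Octonion} {x : E} (hf : ContDiffAt ℝ n f x)
    (hg : ContDiffAt ℝ n g x) : ContDiffAt ℝ n (fun y => f y * g y) x :=
  Octonion.contDiff_mul.contDiffAt.comp x (hf.prodMk hg)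

theorem ContDiffAt.octonion_star {E : Type*} [NormedAddCommGroup E] [NormedSpace ℝ E]
    {n : WithTop ℕ∞} {f : E → Octonion} {x : E} (hf : ContDiffAt ℝ n f x) :
    ContDiffAt ℝ n (fun y => star (f y)) x :=
  Octonion.starL.contDiff.contDiffAt.comp x hf

theorem ContDiffAt.octonion_inv {E : Type*} [NormedAddCommGroup E] [NormedSpace ℝ E]
    {n : WithTop ℕ∞} {f : E → Octonion} {x : E} (hf : ContDiffAt ℝ n f x) (hx : f x ≠ 0) :
    ContDiffAt ℝ n (fun y => (f y)⁻¹) x :=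
  (Octonion.contDiffAt_inv hx).comp x hf

theorem HasFDerivAt.octonion_mul {E : Type*} [NormedAddCommGroup E] [NormedSpace ℝ E]
    {f g : E → Octonion} {f' g' : E →L[ℝ] Octonion} {x : E} (hf : HasFDerivAt f f' x)
    (hg : HasFDerivAt g g' x) : HasFDerivAt (fun y => f y * g y)
      (Octonion.mulL.precompR E (f x) g' + Octonion.mulL.precompL E f' (g x)) x :=
  Octonion.mulL.hasFDerivAt_of_bilinear hf hg

theorem Octonion.mulL_apply (x y : Octonion) : Octonion.mulL x y = x * y := rfl

theorem Octonion.starL_apply (x : Octonion) : Octonion.starL x = star x := rfl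

/-! ### The chart expression is a semi-Riemannian metric -/

namespace OP11

/-- The denominator `1 + |u|² - |v|²`. -/
noncomputable def denom (y : Octonion × Octonion) : ℝ := 1 + ‖y.1‖ ^ 2 - ‖y.2‖ ^ 2

theorem denom_pos {y : Octonion × Octonion} (hy : y ∈ domain) : 0 < denom y := hy

/-- With z isolated in the second slot, the metric becomes a 2 × 2 octonionic matrix with
off-diagonal entries u v̄ and its conjugate. -/
theorem coordMetric_eq (y w z : Octonion × Octonion) : coordMetric y w z =
    (inner ℝ ((1 - ‖y.2‖ ^ 2) • w.1 + y.1 * star y.2 * w.2) z.1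
      + inner ℝ (y.2 * star y.1 * w.1 - (1 + ‖y.1‖ ^ 2) • w.2) z.2) / denom y ^ 2 := by
  have h : inner ℝ (y.1 * star y.2 * z.2) w.1 = inner ℝ (y.2 * star y.1 * w.1) z.2 := by
    rw [Octonion.inner_mul_left, Octonion.star_mul', Octonion.star_star', real_inner_comm]
  rw [coordMetric_apply, coordMetricFun, Octonion.re_mul_mul_star, Octonion.re_mul_mul_star, h,
    denom]
  simp only [inner_add_left, inner_sub_left, real_inner_smul_left]
  ring

theorem coordMetric_symm (y w z : Octonion × Octonion) :
    coordMetric y w z = coordMetric y z w := by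
  simp only [coordMetric_apply, coordMetricFun, real_inner_comm]
  ring

/-- A determinant computation. With m = u v̄, the equations m w₂ = -(1 - |v|²) w₁ and m̄ w₁ = (1 +
|u|²) w₂, multiplied by m̄ and m, combine to (1 + |u|² - |v|²) w = 0, since (1 - |v|²)(1 + |u|²) +
|u|²|v|² is the denominator. -/
theorem coordMetric_nondegenerate {y : Octonion × Octonion} (hy : y ∈ domain)
    (w : Octonion × Octonion) (h : ∀ z, coordMetric y w z = 0) : w = 0 := by
  have hD := denom_pos hy
  have h1 : (1 - ‖y.2‖ ^ 2) • w.1 + y.1 * star y.2 * w.2 = 0 := by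
    refine ext_inner_right ℝ fun z => ?_
    have h' := h (z, 0)
    rw [coordMetric_eq, div_eq_zero_iff, or_iff_left (by positivity)] at h'
    simpa using h'
  have h2 : y.2 * star y.1 * w.1 - (1 + ‖y.1‖ ^ 2) • w.2 = 0 := by
    refine ext_inner_right ℝ fun z => ?_
    have h' := h (0, z)
    rw [coordMetric_eq, div_eq_zero_iff, or_iff_left (by positivity)] at h'
    simpa using h'
  have hm : ‖y.1 * star y.2‖ ^ 2 = ‖y.1‖ ^ 2 * ‖y.2‖ ^ 2 := by
    rw [Octonion.norm_mul, Octonion.norm_star, mul_pow]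
  have hs : star (y.1 * star y.2) = y.2 * star y.1 := by
    rw [Octonion.star_mul', Octonion.star_star']
  have h3 := Octonion.star_mul_mul (y.1 * star y.2) w.2
  have h4 := Octonion.mul_star_mul' (y.1 * star y.2) w.1
  rw [hs, hm] at h3 h4
  rw [sub_eq_zero] at h2
  have h5 : y.1 * star y.2 * w.2 = (-(1 - ‖y.2‖ ^ 2)) • w.1 := by
    rw [neg_smul]; exact eq_neg_of_add_eq_zero_right h1
  rw [h2, Octonion.mul_smul, h5] at h4
  rw [h5, Octonion.mul_smul, h2] at h3
  have h6 : denom y • w.1 = 0 := by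
    rw [← sub_eq_zero] at h4
    rw [← neg_eq_zero, ← h4, denom]
    module
  have h7 : denom y • w.2 = 0 := by
    rw [← sub_eq_zero] at h3
    rw [← neg_eq_zero, ← h3, denom]
    module
  exact Prod.ext ((smul_eq_zero_iff_right hD.ne').1 h6) ((smul_eq_zero_iff_right hD.ne').1 h7)

theorem contDiff_denom {n : WithTop ℕ∞} : ContDiff ℝ n denom :=
  (contDiff_const.add (contDiff_fst.norm_sq ℝ)).sub (contDiff_snd.norm_sq ℝ)

theorem contDiffOn_coordMetric : ContDiffOn ℝ ∞ coordMetric domain := by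
  refine contDiffOn_clm_apply.2 fun w => contDiffOn_clm_apply.2 fun z y hy => ?_
  simp only [coordMetric_eq]
  refine ContDiffAt.contDiffWithinAt (ContDiffAt.div ?_ (contDiff_denom.contDiffAt.pow 2)
    (pow_ne_zero 2 (denom_pos hy).ne'))
  have h1 : ContDiffAt ℝ ∞ (fun y : Octonion × Octonion => y.1) y := contDiffAt_fst
  have h2 : ContDiffAt ℝ ∞ (fun y : Octonion × Octonion => y.2) y := contDiffAt_snd
  exact (((((contDiffAt_const.sub (h2.norm_sq ℝ)).smul contDiffAt_const).add
    ((h1.octonion_mul h2.octonion_star).octonion_mul contDiffAt_const)).inner ℝ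
      contDiffAt_const)).add
    ((((h2.octonion_mul h1.octonion_star).octonion_mul contDiffAt_const).sub
      ((contDiffAt_const.add (h1.norm_sq ℝ)).smul contDiffAt_const)).inner ℝ contDiffAt_const)

theorem isMetricOn_coordMetric : SemiRiemannian.IsMetricOn coordMetric domain where
  isOpen := isOpen_domain
  symm p _ v w := coordMetric_symm p v w
  nondegenerate _ hp v h := coordMetric_nondegenerate hp v h
  smooth := contDiffOn_coordMetric

/-! ### The Veronese embedding -/

/-- Hermitian `3 × 3` matrices over the octonions: the diagonal entries, followed by the entries in
the positions `(2, 1)`, `(3, 1)` and `(2, 3)`. -/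
abbrev Herm : Type := ℝ × ℝ × ℝ × Octonion × Octonion × Octonion

/-- The trace form, twisted by the signature `(1, 1, -1)`. -/
noncomputable def traceForm (X : Herm) : ℝ :=
  X.1 ^ 2 + X.2.1 ^ 2 + X.2.2.1 ^ 2
    + 2 * (‖X.2.2.2.1‖ ^ 2 - ‖X.2.2.2.2.1‖ ^ 2 - ‖X.2.2.2.2.2‖ ^ 2)

/-- The matrix `x x*` of the column vector `x = (1, u, v)`. -/
noncomputable def rankOne (y : Octonion × Octonion) : Herm :=
  (1, ‖y.1‖ ^ 2, ‖y.2‖ ^ 2, y.1, y.2, y.1 * star y.2)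

/-- The Veronese embedding: `x x*`, normalized. -/
noncomputable def veronese (y : Octonion × Octonion) : Herm := (denom y)⁻¹ • rankOne y

theorem contDiff_rankOne {n : WithTop ℕ∞} : ContDiff ℝ n rankOne :=
  contDiff_const.prodMk ((contDiff_fst.norm_sq ℝ).prodMk ((contDiff_snd.norm_sq ℝ).prodMk
    (contDiff_fst.prodMk (contDiff_snd.prodMk (contDiff_iff_contDiffAt.2 fun _ =>
      contDiffAt_fst.octonion_mul contDiffAt_snd.octonion_star)))))

theorem fderiv_rankOne (y w : Octonion × Octonion) :
    fderiv ℝ rankOne y w = (0, 2 * inner ℝ y.1 w.1, 2 * inner ℝ y.2 w.2, w.1, w.2,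
      y.1 * star w.2 + w.1 * star y.2) := by
  have h1 : HasFDerivAt (𝕜 := ℝ) (fun y : Octonion × Octonion => y.1) _ y := hasFDerivAt_fst
  have h2 : HasFDerivAt (𝕜 := ℝ) (fun y : Octonion × Octonion => y.2) _ y := hasFDerivAt_snd
  have h3 := (hasFDerivAt_const (1 : ℝ) y).prodMk (h1.norm_sq.prodMk (h2.norm_sq.prodMk
    (h1.prodMk (h2.prodMk (h1.octonion_mul (Octonion.starL.hasFDerivAt.comp y h2))))))
  have h4 : HasFDerivAt rankOne _ y := h3
  rw [h4.fderiv]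
  simp [Octonion.mulL_apply, Octonion.starL_apply]

theorem fderiv_denom (y w : Octonion × Octonion) :
    fderiv ℝ denom y w = 2 * (inner ℝ y.1 w.1 - inner ℝ y.2 w.2) := by
  have h1 : HasFDerivAt (𝕜 := ℝ) (fun y : Octonion × Octonion => y.1) _ y := hasFDerivAt_fst
  have h2 : HasFDerivAt (𝕜 := ℝ) (fun y : Octonion × Octonion => y.2) _ y := hasFDerivAt_snd
  have h3 : HasFDerivAt denom _ y := ((hasFDerivAt_const (1 : ℝ) y).add h1.norm_sq).sub h2.norm_sq
  rw [h3.fderiv]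
  simp
  ring

theorem contDiffAt_veronese {n : WithTop ℕ∞} {y : Octonion × Octonion} (hy : y ∈ domain) :
    ContDiffAt ℝ n veronese y :=
  (contDiff_denom.contDiffAt.inv (denom_pos hy).ne').smul contDiff_rankOne.contDiffAt

theorem fderiv_veronese {y : Octonion × Octonion} (hy : y ∈ domain) (w : Octonion × Octonion) :
    fderiv ℝ veronese y w = (denom y)⁻¹ • fderiv ℝ rankOne y w
      + (-(fderiv ℝ denom y w / denom y ^ 2)) • rankOne y := by
  have h1 := ((contDiff_denom (n := 1)).differentiable (by simp) y).hasFDerivAt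
  have h2 := ((contDiff_rankOne (n := 1)).differentiable (by simp) y).hasFDerivAt
  have h3 : HasFDerivAt veronese _ y := ((hasDerivAt_inv (denom_pos hy).ne').comp_hasFDerivAt y
    h1).smul h2
  rw [h3.fderiv]
  simp only [add_apply, smul_apply, ContinuousLinearMap.smulRight_apply, smul_eq_mul]
  congr 2
  ring

/-- The metric is half the pullback of the trace form. -/
theorem coordMetric_self {y : Octonion × Octonion} (hy : y ∈ domain) (w : Octonion × Octonion) :
    coordMetric y w w = traceForm (fderiv ℝ veronese y w) / 2 := by
  have hD := (denom_pos hy).ne'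
  -- The product from the norm of d(u v̄) in which the factors stand in the wrong order; the
  -- exchange law turns it into the mixed term of ds².
  have h1 : inner ℝ (y.1 * star w.2) (w.1 * star y.2) = 2 * inner ℝ y.1 w.1 * inner ℝ y.2 w.2
      - inner ℝ (y.1 * star y.2 * w.2) w.1 := by
    have h := Octonion.inner_mul_mul_add y.1 (star w.2) w.1 (star y.2)
    rw [Octonion.inner_star_star, real_inner_comm y.2 w.2,
      ← Octonion.inner_mul_right (y.1 * star y.2) w.2 w.1] at h
    linarith
  have h2 : inner ℝ (y.1 * star w.2) (y.1 * star y.2) = ‖y.1‖ ^ 2 * inner ℝ y.2 w.2 := by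
    rw [Octonion.inner_mul_left, Octonion.star_mul_mul, real_inner_smul_right,
      Octonion.inner_star_star, real_inner_comm]
  have h3 : inner ℝ (w.1 * star y.2) (y.1 * star y.2) = ‖y.2‖ ^ 2 * inner ℝ y.1 w.1 := by
    rw [Octonion.inner_mul_right, Octonion.star_star', Octonion.mul_star_mul,
      real_inner_smul_right, real_inner_comm]
  have h4 : inner ℝ (y.2 * star y.1 * w.1) w.2 = inner ℝ (y.1 * star y.2 * w.2) w.1 := by
    rw [Octonion.inner_mul_left, Octonion.star_mul', Octonion.star_star', real_inner_comm]
  rw [fderiv_veronese hy, fderiv_rankOne, fderiv_denom, rankOne, coordMetric_eq]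
  simp only [traceForm, Prod.smul_mk, Prod.mk_add_mk, smul_eq_mul, norm_add_sq_real, norm_smul,
    real_inner_smul_left, real_inner_smul_right, mul_pow, Real.norm_eq_abs, sq_abs, inner_add_left,
    inner_sub_left, Octonion.norm_mul, Octonion.norm_star, real_inner_self_eq_norm_sq, h1, h2, h3,
    h4, real_inner_comm y.1 w.1, real_inner_comm y.2 w.2]
  have hd : denom y = 1 + ‖y.1‖ ^ 2 - ‖y.2‖ ^ 2 := rfl
  rw [hd] at hD ⊢
  field_simp
  ring

/-- Differentiating `veronese ∘ φ = A ∘ veronese` shows that Dφ preserves the pullback of the form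
on single vectors; polarization gives the bilinear statement. -/
theorem isLocalIsometryAt_of_veronese {φ : Octonion × Octonion → Octonion × Octonion}
    {y : Octonion × Octonion} (A : Herm →ₗ[ℝ] Herm) (hA : ∀ X, traceForm (A X) = traceForm X)
    (hφ : ContDiffAt ℝ 3 φ y) (hy : y ∈ domain) (hy' : φ y ∈ domain)
    (h : ∀ᶠ z in nhds y, veronese (φ z) = A (veronese z)) :
    SemiRiemannian.IsLocalIsometryAt coordMetric φ y := by
  refine ⟨hφ, ?_⟩
  filter_upwards [hφ.eventually (by simp), isOpen_domain.mem_nhds hy,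
    hφ.continuousAt.eventually (isOpen_domain.mem_nhds hy'), h.eventually_nhds] with z h1 h2 h3 h4
  have h5 := h1.differentiableAt (by simp)
  have hself : ∀ w, coordMetric z w w = coordMetric (φ z) (fderiv ℝ φ z w) (fderiv ℝ φ z w) := by
    intro w
    have h6 := Filter.EventuallyEq.fderiv_eq (𝕜 := ℝ) (f₁ := veronese ∘ φ)
      (f := A.toContinuousLinearMap ∘ veronese) h4
    rw [fderiv_comp z ((contDiffAt_veronese (n := 1) h3).differentiableAt (by simp)) h5,
      fderiv_comp z A.toContinuousLinearMap.differentiableAt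
        ((contDiffAt_veronese (n := 1) h2).differentiableAt (by simp)),
      ContinuousLinearMap.fderiv] at h6
    have h7 := congrArg (fun l => l w) h6
    simp only [ContinuousLinearMap.comp_apply] at h7
    rw [coordMetric_self h2, coordMetric_self h3, h7]
    exact congrArg (· / 2) (hA _).symm
  intro v w
  have h8 := hself (v + w)
  simp only [map_add, add_apply, ← hself v, ← hself w, coordMetric_symm z w v,
    coordMetric_symm (φ z) (fderiv ℝ φ z w)] at h8
  linarith

end OP11

/-! ### Division by an octonion, with denominators cleared -/

namespace Octonion

theorem inner_one_left (x : Octonion) : inner ℝ 1 x = re x := by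
  rw [real_inner_comm, inner_one_right]

theorem smul_mul_inv {p : Octonion} (hp : p ≠ 0) (x : Octonion) :
    ‖p‖ ^ 2 • (x * p⁻¹) = x * star p := by
  have h : ‖p‖ ^ 2 ≠ 0 := pow_ne_zero 2 (norm_ne_zero_iff.2 hp)
  rw [inv_def, mul_smul, smul_smul, mul_inv_cancel₀ h, one_smul]

theorem norm_sq_mul_norm_sq_mul_inv {p : Octonion} (hp : p ≠ 0) (x : Octonion) :
    ‖p‖ ^ 2 * ‖x * p⁻¹‖ ^ 2 = ‖x‖ ^ 2 := by
  have h : ‖p‖ ≠ 0 := norm_ne_zero_iff.2 hp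
  rw [norm_mul, norm_inv]
  field_simp

theorem smul_mul_inv_mul_star {p : Octonion} (hp : p ≠ 0) (x y : Octonion) :
    ‖p‖ ^ 2 • (x * p⁻¹ * star (y * p⁻¹)) = (‖p‖ ^ 2)⁻¹ • (x * star p * (p * star y)) := by
  have h : ‖p‖ ^ 2 ≠ 0 := pow_ne_zero 2 (norm_ne_zero_iff.2 hp)
  rw [← smul_mul, smul_mul_inv hp, inv_def, mul_smul, star_smul, star_mul', star_star', mul_smul]

end Octonion

namespace OP11

open Octonion SemiRiemannian

/-! ### Isometries -/

/-- The map of the affine plane induced by `(a, b, c) ↦ (αa + βb, γa + δb, c)`. -/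
noncomputable def planarMap (α β γ δ : ℝ) (y : Octonion × Octonion) : Octonion × Octonion :=
  ((γ • 1 + δ • y.1) * (α • 1 + β • y.1)⁻¹, y.2 * (α • 1 + β • y.1)⁻¹)

/-- The action on Hermitian matrices that corresponds to `planarMap`. -/
noncomputable def planarAction (α β γ δ : ℝ) : Herm →ₗ[ℝ] Herm where
  toFun X := (α ^ 2 * X.1 + 2 * α * β * re X.2.2.2.1 + β ^ 2 * X.2.1,
    γ ^ 2 * X.1 + 2 * γ * δ * re X.2.2.2.1 + δ ^ 2 * X.2.1, X.2.2.1,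
    (γ * α * X.1 + 2 * γ * β * re X.2.2.2.1 + δ * β * X.2.1) • (1 : Octonion)
      + (δ * α - γ * β) • X.2.2.2.1,
    α • X.2.2.2.2.1 + β • star X.2.2.2.2.2, γ • star X.2.2.2.2.1 + δ • X.2.2.2.2.2)
  map_add' X Y := by
    simp only [Prod.fst_add, Prod.snd_add, Prod.mk_add_mk, re_add, Octonion.star_add, Prod.mk.injEq]
    refine ⟨by ring, by ring, trivial, by module, by module, by module⟩
  map_smul' r X := by
    simp only [Prod.smul_fst, Prod.smul_snd, Prod.smul_mk, re_smul, Octonion.star_smul, Prod.mk.injEq,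
      smul_eq_mul, RingHom.id_apply]
    refine ⟨by ring, by ring, trivial, by module, by module, by module⟩

theorem norm_sq_smul_add_smul (a b : ℝ) (x y : Octonion) :
    ‖a • x + b • y‖ ^ 2 = a ^ 2 * ‖x‖ ^ 2 + 2 * a * b * inner ℝ x y + b ^ 2 * ‖y‖ ^ 2 := by
  rw [norm_add_sq_real, norm_smul, norm_smul, real_inner_smul_left, real_inner_smul_right,
    mul_pow, mul_pow, Real.norm_eq_abs, Real.norm_eq_abs, sq_abs, sq_abs]
  ring

/-- Conjugation by a real orthogonal matrix acting on the two coordinates of equal sign preserves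
the trace form. Besides the real diagonal entries only re x, three norms and one inner product
enter, so the claim is a polynomial identity modulo the orthogonality relations. -/
theorem traceForm_planarAction {α β γ δ : ℝ} (h₁ : α ^ 2 + γ ^ 2 = 1) (h₂ : β ^ 2 + δ ^ 2 = 1)
    (h₃ : α * β + γ * δ = 0) (X : Herm) :
    traceForm (planarAction α β γ δ X) = traceForm X := by
  obtain ⟨p, q, n, x, y, m⟩ := X
  have h : inner ℝ y (star m) = inner ℝ (star y) m := by
    rw [← inner_star_star, star_star']
  simp only [traceForm, planarAction, LinearMap.coe_mk, AddHom.coe_mk, norm_sq_smul_add_smul,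
    Octonion.norm_star, h, Octonion.norm_one, inner_one_left, one_pow]
  generalize re x = r
  generalize ‖x‖ ^ 2 = N
  generalize ‖y‖ ^ 2 = Y
  generalize ‖m‖ ^ 2 = M
  generalize inner ℝ (star y) m = k
  grind

/-- The form |a|² + |b|² - |c|² is invariant; the factor |α + βu|⁻² comes from renormalizing the
first coordinate to 1. -/
theorem denom_planarMap {α β γ δ : ℝ} (h₁ : α ^ 2 + γ ^ 2 = 1) (h₂ : β ^ 2 + δ ^ 2 = 1)
    (h₃ : α * β + γ * δ = 0) {y : Octonion × Octonion} (hy : α • 1 + β • y.1 ≠ 0) :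
    denom (planarMap α β γ δ y) = denom y / ‖α • 1 + β • y.1‖ ^ 2 := by
  have hP : ‖α • 1 + β • y.1‖ ^ 2 ≠ 0 := pow_ne_zero 2 (norm_ne_zero_iff.2 hy)
  simp only [denom, planarMap, Octonion.norm_mul, Octonion.norm_inv, mul_pow, inv_pow]
  field_simp
  simp only [norm_sq_affine]
  linear_combination h₁ + ‖y.1‖ ^ 2 * h₂ + 2 * re y.1 * h₃

theorem planarMap_mem {α β γ δ : ℝ} (h₁ : α ^ 2 + γ ^ 2 = 1) (h₂ : β ^ 2 + δ ^ 2 = 1)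
    (h₃ : α * β + γ * δ = 0) {y : Octonion × Octonion} (hy : y ∈ domain)
    (hP : α • 1 + β • y.1 ≠ 0) : planarMap α β γ δ y ∈ domain := by
  change 0 < denom _
  rw [denom_planarMap h₁ h₂ h₃ hP]
  exact div_pos (denom_pos hy) (pow_pos (norm_pos_iff.2 hP) 2)

/-- Put p = α + βu and q = γ + δu. The change of denominator supplies the factor |p|² that clears
p⁻¹, and the mixed entry (q p̄)(p v̄) / |p|² becomes q v̄ because p and q lie in ℝ1 + ℝu. All
entries are then linear in those of x x*. -/
theorem veronese_planarMap {α β γ δ : ℝ} (h₁ : α ^ 2 + γ ^ 2 = 1) (h₂ : β ^ 2 + δ ^ 2 = 1)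
    (h₃ : α * β + γ * δ = 0) {y : Octonion × Octonion} (hP : α • 1 + β • y.1 ≠ 0) :
    veronese (planarMap α β γ δ y) = planarAction α β γ δ (veronese y) := by
  have hN : ‖α • 1 + β • y.1‖ ^ 2 ≠ 0 := pow_ne_zero 2 (norm_ne_zero_iff.2 hP)
  rw [veronese, veronese, map_smul, denom_planarMap h₁ h₂ h₃ hP, inv_div, div_eq_inv_mul,
    ← smul_smul]
  congr 1
  simp only [rankOne, planarMap, planarAction, LinearMap.coe_mk, AddHom.coe_mk, Prod.smul_mk,
    smul_eq_mul, norm_sq_mul_norm_sq_mul_inv hP, smul_mul_inv hP, smul_mul_inv_mul_star hP,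
    affine_mul_star_mul, smul_smul, inv_mul_cancel₀ hN, one_smul]
  simp only [norm_sq_affine, Prod.mk.injEq]
  refine ⟨by ring, by ring, trivial, ?_, ?_, ?_⟩
  · simp only [Octonion.star_add, Octonion.star_smul, star_one', Octonion.add_mul, Octonion.mul_add,
      Octonion.smul_mul, Octonion.mul_smul, Octonion.one_mul, Octonion.mul_one, mul_star_self]
    rw [star_eq y.1]
    module
  · rw [Octonion.star_mul', star_star', Octonion.star_add, Octonion.star_smul, Octonion.star_smul, star_one', Octonion.mul_add,
      Octonion.mul_smul, Octonion.mul_smul, Octonion.mul_one]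
  · rw [Octonion.add_mul, Octonion.smul_mul, Octonion.smul_mul, Octonion.one_mul]

theorem contDiffAt_planarMap {α β γ δ : ℝ} {n : WithTop ℕ∞} {y : Octonion × Octonion}
    (hP : α • 1 + β • y.1 ≠ 0) : ContDiffAt ℝ n (planarMap α β γ δ) y := by
  have h1 : ContDiffAt ℝ n (fun y : Octonion × Octonion => y.1) y := contDiffAt_fst
  have h2 : ContDiffAt ℝ n (fun y : Octonion × Octonion => y.2) y := contDiffAt_snd
  have h3 : ∀ a b : ℝ, ContDiffAt ℝ n
      (fun y : Octonion × Octonion => a • (1 : Octonion) + b • y.1) y := fun a b =>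
    contDiffAt_const.add (h1.const_smul b)
  exact ((h3 γ δ).octonion_mul ((h3 α β).octonion_inv hP)).prodMk
    (h2.octonion_mul ((h3 α β).octonion_inv hP))

theorem isLocalIsometryAt_planarMap {α β γ δ : ℝ} (h₁ : α ^ 2 + γ ^ 2 = 1)
    (h₂ : β ^ 2 + δ ^ 2 = 1) (h₃ : α * β + γ * δ = 0) {y : Octonion × Octonion} (hy : y ∈ domain)
    (hP : α • 1 + β • y.1 ≠ 0) : IsLocalIsometryAt coordMetric (planarMap α β γ δ) y := by
  have hopen : IsOpen {z : Octonion × Octonion | α • 1 + β • z.1 ≠ 0} :=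
    isOpen_ne_fun (by fun_prop) continuous_const
  refine isLocalIsometryAt_of_veronese _ (traceForm_planarAction h₁ h₂ h₃)
    (contDiffAt_planarMap hP) hy (planarMap_mem h₁ h₂ h₃ hy hP) ?_
  filter_upwards [hopen.mem_nhds hP] with z hz
  exact veronese_planarMap h₁ h₂ h₃ hz

/-- Interchanging the first two homogeneous coordinates is a real orthogonal map. This is why the
two chart expressions of the metric agree. -/
theorem isLocalIsometryAt_transition {y : Octonion × Octonion} (hy : y ∈ domain)
    (h : y.1 ≠ 0) : IsLocalIsometryAt coordMetric transition y := by
  have he : planarMap 0 1 1 0 = transition := by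
    ext1 z
    simp [planarMap, transition, Octonion.one_mul]
  rw [← he]
  exact isLocalIsometryAt_planarMap (by norm_num) (by norm_num) (by norm_num) hy (by simpa using h)

/-- The map of the affine plane induced by `(a, b, c) ↦ (αa + βc, b, βa + αc)`. -/
noncomputable def boostMap (α β : ℝ) (y : Octonion × Octonion) : Octonion × Octonion :=
  (y.1 * (α • 1 + β • y.2)⁻¹, (β • 1 + α • y.2) * (α • 1 + β • y.2)⁻¹)

/-- The action on Hermitian matrices that corresponds to `boostMap`. -/
noncomputable def boostAction (α β : ℝ) : Herm →ₗ[ℝ] Herm where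
  toFun X := (α ^ 2 * X.1 + 2 * α * β * re X.2.2.2.2.1 + β ^ 2 * X.2.2.1, X.2.1,
    β ^ 2 * X.1 + 2 * β * α * re X.2.2.2.2.1 + α ^ 2 * X.2.2.1,
    α • X.2.2.2.1 + β • X.2.2.2.2.2,
    (β * α * X.1 + 2 * β ^ 2 * re X.2.2.2.2.1 + α * β * X.2.2.1) • (1 : Octonion)
      + (α ^ 2 - β ^ 2) • X.2.2.2.2.1,
    β • X.2.2.2.1 + α • X.2.2.2.2.2)
  map_add' X Y := by
    simp only [Prod.fst_add, Prod.snd_add, Prod.mk_add_mk, re_add, Prod.mk.injEq]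
    refine ⟨by ring, trivial, by ring, by module, by module, by module⟩
  map_smul' r X := by
    simp only [Prod.smul_fst, Prod.smul_snd, Prod.smul_mk, re_smul, Prod.mk.injEq,
      smul_eq_mul, RingHom.id_apply]
    refine ⟨by ring, trivial, by ring, by module, by module, by module⟩

theorem traceForm_boostAction {α β : ℝ} (h : α ^ 2 - β ^ 2 = 1) (X : Herm) :
    traceForm (boostAction α β X) = traceForm X := by
  obtain ⟨p, q, n, x, y, m⟩ := X
  simp only [traceForm, boostAction, LinearMap.coe_mk, AddHom.coe_mk, norm_sq_smul_add_smul,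
    Octonion.norm_one, inner_one_left, one_pow]
  generalize re y = r
  generalize ‖x‖ ^ 2 = N
  generalize ‖y‖ ^ 2 = Y
  generalize ‖m‖ ^ 2 = M
  generalize inner ℝ x m = k
  grind

/-- Boosts preserve |a|² - |c|²: |α + βv|² - |β + αv|² = (α² - β²)(1 - |v|²). -/
theorem denom_boostMap {α β : ℝ} (h : α ^ 2 - β ^ 2 = 1) {y : Octonion × Octonion}
    (hP : α • 1 + β • y.2 ≠ 0) :
    denom (boostMap α β y) = denom y / ‖α • 1 + β • y.2‖ ^ 2 := by
  have hN : ‖α • 1 + β • y.2‖ ^ 2 ≠ 0 := pow_ne_zero 2 (norm_ne_zero_iff.2 hP)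
  simp only [denom, boostMap, Octonion.norm_mul, Octonion.norm_inv, mul_pow, inv_pow]
  field_simp
  simp only [norm_sq_affine]
  linear_combination (1 - ‖y.2‖ ^ 2) * h

theorem boostMap_mem {α β : ℝ} (h : α ^ 2 - β ^ 2 = 1) {y : Octonion × Octonion}
    (hy : y ∈ domain) (hP : α • 1 + β • y.2 ≠ 0) : boostMap α β y ∈ domain := by
  change 0 < denom _
  rw [denom_boostMap h hP]
  exact div_pos (denom_pos hy) (pow_pos (norm_pos_iff.2 hP) 2)

theorem veronese_boostMap {α β : ℝ} (h : α ^ 2 - β ^ 2 = 1) {y : Octonion × Octonion}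
    (hP : α • 1 + β • y.2 ≠ 0) :
    veronese (boostMap α β y) = boostAction α β (veronese y) := by
  have hN : ‖α • 1 + β • y.2‖ ^ 2 ≠ 0 := pow_ne_zero 2 (norm_ne_zero_iff.2 hP)
  rw [veronese, veronese, map_smul, denom_boostMap h hP, inv_div, div_eq_inv_mul, ← smul_smul]
  congr 1
  simp only [rankOne, boostMap, boostAction, LinearMap.coe_mk, AddHom.coe_mk, Prod.smul_mk,
    smul_eq_mul, norm_sq_mul_norm_sq_mul_inv hP, smul_mul_inv hP, smul_mul_inv_mul_star hP,
    mul_star_mul_affine, smul_smul, inv_mul_cancel₀ hN, one_smul]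
  simp only [norm_sq_affine, Prod.mk.injEq]
  refine ⟨by ring, trivial, by ring, ?_, ?_, ?_⟩
  · rw [Octonion.star_add, Octonion.star_smul, Octonion.star_smul, star_one', Octonion.mul_add,
      Octonion.mul_smul, Octonion.mul_smul, Octonion.mul_one]
  · simp only [Octonion.star_add, Octonion.star_smul, star_one', Octonion.add_mul, Octonion.mul_add,
      Octonion.smul_mul, Octonion.mul_smul, Octonion.one_mul, Octonion.mul_one, mul_star_self]
    rw [star_eq y.2]
    module
  · rw [Octonion.star_add, Octonion.star_smul, Octonion.star_smul, star_one', Octonion.mul_add,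
      Octonion.mul_smul, Octonion.mul_smul, Octonion.mul_one]

theorem isLocalIsometryAt_boostMap {α β : ℝ} (h : α ^ 2 - β ^ 2 = 1) {y : Octonion × Octonion}
    (hy : y ∈ domain) (hP : α • 1 + β • y.2 ≠ 0) :
    IsLocalIsometryAt coordMetric (boostMap α β) y := by
  have hopen : IsOpen {z : Octonion × Octonion | α • 1 + β • z.2 ≠ 0} :=
    isOpen_ne_fun (by fun_prop) continuous_const
  have hsmooth : ContDiffAt ℝ 3 (boostMap α β) y := by
    have h1 : ContDiffAt ℝ 3 (fun y : Octonion × Octonion => y.1) y := contDiffAt_fst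
    have h2 : ContDiffAt ℝ 3 (fun y : Octonion × Octonion => y.2) y := contDiffAt_snd
    have h3 : ∀ a b : ℝ, ContDiffAt ℝ 3
        (fun y : Octonion × Octonion => a • (1 : Octonion) + b • y.2) y := fun a b =>
      contDiffAt_const.add (h2.const_smul b)
    exact (h1.octonion_mul ((h3 α β).octonion_inv hP)).prodMk
      ((h3 β α).octonion_mul ((h3 α β).octonion_inv hP))
  refine isLocalIsometryAt_of_veronese _ (traceForm_boostAction h) hsmooth hy
    (boostMap_mem h hy hP) ?_
  filter_upwards [hopen.mem_nhds hP] with z hz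
  exact veronese_boostMap h hz

/-- The map `(u, v) ↦ (a u, ā v)`. -/
noncomputable def twist (a : Octonion) (y : Octonion × Octonion) : Octonion × Octonion :=
  (a * y.1, star a * y.2)

/-- The action on Hermitian matrices that corresponds to `twist`. -/
noncomputable def twistAction (a : Octonion) : Herm →ₗ[ℝ] Herm where
  toFun X := (X.1, X.2.1, X.2.2.1, a * X.2.2.2.1, star a * X.2.2.2.2.1,
    (2 * inner ℝ a (star X.2.2.2.2.2)) • a + (-1 : ℝ) • star X.2.2.2.2.2)
  map_add' X Y := by
    simp only [Prod.fst_add, Prod.snd_add, Prod.mk_add_mk, Octonion.star_add, Octonion.mul_add,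
      Prod.mk.injEq, inner_add_right, true_and]
    module
  map_smul' r X := by
    simp only [Prod.smul_fst, Prod.smul_snd, Prod.smul_mk, Octonion.star_smul, Octonion.mul_smul,
      Prod.mk.injEq, inner_smul_right, true_and, RingHom.id_apply]
    module

/-- For |a| = 1 the last entry is the reflection of m̄ in the line ℝa, hence norm-preserving; the
other off-diagonal entries are multiplied by unit octonions. -/
theorem traceForm_twistAction {a : Octonion} (ha : ‖a‖ = 1) (X : Herm) :
    traceForm (twistAction a X) = traceForm X := by
  simp only [traceForm, twistAction, LinearMap.coe_mk, AddHom.coe_mk, norm_sq_smul_add_smul,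
    Octonion.norm_star, Octonion.norm_mul, ha]
  ring

theorem isLocalIsometryAt_twist {a : Octonion} (ha : ‖a‖ = 1) {y : Octonion × Octonion}
    (hy : y ∈ domain) : IsLocalIsometryAt coordMetric (twist a) y := by
  have hden : ∀ z, denom (twist a z) = denom z := fun z => by
    simp only [denom, twist, Octonion.norm_mul, Octonion.norm_star, ha, _root_.one_mul]
  have hsmooth : ContDiffAt ℝ 3 (twist a) y :=
    (contDiffAt_const.octonion_mul contDiffAt_fst).prodMk
      (contDiffAt_const.octonion_mul contDiffAt_snd)
  refine isLocalIsometryAt_of_veronese _ (traceForm_twistAction ha) hsmooth hy ?_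
    (Filter.Eventually.of_forall fun z => ?_)
  · change 0 < denom _
    rw [hden]
    exact hy
  · rw [veronese, veronese, map_smul, hden]
    congr 1
    simp only [rankOne, twist, twistAction, LinearMap.coe_mk, AddHom.coe_mk, Octonion.norm_mul,
      Octonion.norm_star, ha, _root_.one_mul, Prod.mk.injEq, true_and]
    -- The mixed entry of the twisted point is (a u)(v̄ a), which Moufang expresses through u v̄
    -- alone.
    rw [Octonion.star_mul' (star a), star_star', moufang, ha]
    module

theorem twist_mem {a : Octonion} (ha : ‖a‖ = 1) {y : Octonion × Octonion} (hy : y ∈ domain) :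
    twist a y ∈ domain := by
  change 0 < 1 + ‖a * y.1‖ ^ 2 - ‖star a * y.2‖ ^ 2
  rw [Octonion.norm_mul, Octonion.norm_mul, Octonion.norm_star, ha, _root_.one_mul, _root_.one_mul]
  exact hy

theorem exists_unit_mul_eq (x : Octonion) :
    ∃ a : Octonion, ‖a‖ = 1 ∧ a * x = ‖x‖ • (1 : Octonion) := by
  by_cases hx : x = 0
  · exact ⟨1, Octonion.norm_one, by simp [hx, Octonion.mul_zero]⟩
  · have h : ‖x‖ ≠ 0 := norm_ne_zero_iff.2 hx
    refine ⟨‖x‖⁻¹ • star x, ?_, ?_⟩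
    · rw [norm_smul, Octonion.norm_star, _root_.norm_inv, norm_norm, inv_mul_cancel₀ h]
    · have h1 := mul_star_mul 1 x
      rw [Octonion.one_mul] at h1
      rw [Octonion.smul_mul, h1, smul_smul]
      congr 1
      field_simp

/-- The local isometries act transitively. -/
theorem exists_isLocalIsometryAt {y : Octonion × Octonion} (hy : y ∈ domain) :
    ∃ φ, IsLocalIsometryAt coordMetric φ y ∧ φ y = 0 := by
  -- A twist makes the first coordinate a real number r ≥ 0.
  obtain ⟨a, ha, hau⟩ := exists_unit_mul_eq y.1
  set y₁ := twist a y with hy₁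
  have hm₁ : y₁ ∈ domain := twist_mem ha hy
  set r := ‖y.1‖
  have hy₁r : y₁.1 = r • 1 := hau
  have hr : (0 : ℝ) < 1 + r ^ 2 := by positivity
  -- The rotation with cosine 1/k and sine r/k takes the direction (1, r) to (k, 0), so it kills the
  -- first coordinate.
  set k := Real.sqrt (1 + r ^ 2)
  have hk : 0 < k := Real.sqrt_pos.2 hr
  have hk2 : k ^ 2 = 1 + r ^ 2 := Real.sq_sqrt hr.le
  have hP₁ : k⁻¹ • 1 + (r * k⁻¹) • y₁.1 ≠ 0 := by
    rw [hy₁r, smul_smul, ← add_smul]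
    refine smul_ne_zero ?_ Octonion.one_ne_zero
    have : 0 < k⁻¹ + r * k⁻¹ * r := by
      have := inv_pos.2 hk
      have := mul_nonneg this.le (sq_nonneg r)
      nlinarith
    exact this.ne'
  have e₁ : k⁻¹ ^ 2 + (-r * k⁻¹) ^ 2 = 1 := by field_simp; linarith
  have e₂ : (r * k⁻¹) ^ 2 + k⁻¹ ^ 2 = 1 := by field_simp; linarith
  have e₃ : k⁻¹ * (r * k⁻¹) + -r * k⁻¹ * k⁻¹ = 0 := by ring
  set y₂ := planarMap k⁻¹ (r * k⁻¹) (-r * k⁻¹) k⁻¹ y₁ with hy₂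
  have hm₂ : y₂ ∈ domain := planarMap_mem e₁ e₂ e₃ hm₁ hP₁
  have hy₂0 : y₂.1 = 0 := by
    have h : (-r * k⁻¹) • (1 : Octonion) + k⁻¹ • y₁.1 = 0 := by
      rw [hy₁r]
      module
    simp only [hy₂, planarMap, h, Octonion.zero_mul]
  -- A twist acts on the second coordinate through the conjugate, so the twist by b̄ makes that
  -- coordinate real; the first one stays 0.
  obtain ⟨b, hb, hbv⟩ := exists_unit_mul_eq y₂.2
  have hb' : ‖star b‖ = 1 := by rw [Octonion.norm_star, hb]
  set y₃ := twist (star b) y₂ with hy₃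
  have hm₃ : y₃ ∈ domain := twist_mem hb' hm₂
  have hy₃0 : y₃.1 = 0 := by simp only [hy₃, twist, hy₂0, Octonion.mul_zero]
  set t := ‖y₂.2‖
  have hy₃t : y₃.2 = t • 1 := by simp only [hy₃, twist, star_star', hbv]
  have ht : 0 < 1 - t ^ 2 := by
    have h : 0 < 1 + ‖y₃.1‖ ^ 2 - ‖y₃.2‖ ^ 2 := hm₃
    rw [hy₃0, hy₃t, norm_smul, Octonion.norm_one] at h
    simpa using h
  -- Membership in the domain has forced t < 1, so a boost with velocity -t exists; it kills the
  -- second coordinate and fixes the vanishing first one.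
  set l := Real.sqrt (1 - t ^ 2)
  have hl : 0 < l := Real.sqrt_pos.2 ht
  have hl2 : l ^ 2 = 1 - t ^ 2 := Real.sq_sqrt ht.le
  have hP₃ : l⁻¹ • 1 + (-t * l⁻¹) • y₃.2 ≠ 0 := by
    rw [hy₃t, smul_smul, ← add_smul]
    refine smul_ne_zero ?_ Octonion.one_ne_zero
    have h : l⁻¹ + -t * l⁻¹ * t = (1 - t ^ 2) * l⁻¹ := by ring
    rw [h]
    exact (mul_pos ht (inv_pos.2 hl)).ne'
  have e₄ : l⁻¹ ^ 2 - (-t * l⁻¹) ^ 2 = 1 := by field_simp; linarith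
  refine ⟨boostMap l⁻¹ (-t * l⁻¹) ∘ twist (star b) ∘ planarMap k⁻¹ (r * k⁻¹) (-r * k⁻¹) k⁻¹ ∘
    twist a, ?_, ?_⟩
  · exact (isLocalIsometryAt_boostMap e₄ hm₃ hP₃).comp ((isLocalIsometryAt_twist hb' hm₂).comp
      ((isLocalIsometryAt_planarMap e₁ e₂ e₃ hm₁ hP₁).comp (isLocalIsometryAt_twist ha hy)))
  · change boostMap l⁻¹ (-t * l⁻¹) y₃ = 0
    have h : (-t * l⁻¹) • (1 : Octonion) + l⁻¹ • y₃.2 = 0 := by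
      rw [hy₃t]
      module
    simp only [boostMap, h, hy₃0, Octonion.zero_mul]
    rfl

end OP11

/-! ### Curvature at a point where the first derivatives of the metric vanish -/

namespace SemiRiemannian

variable {E : Type*} [NormedAddCommGroup E] [NormedSpace ℝ E] [FiniteDimensional ℝ E]
  {G : E → E →L[ℝ] E →L[ℝ] ℝ} {U : Set E} {p : E}

theorem IsMetricOn.christoffel_eq_zero (hG : IsMetricOn G U) (hp : p ∈ U) (h : fderiv ℝ G p = 0)
    (v w : E) : christoffel G p v w = 0 := by
  refine hG.nondegenerate p hp _ fun z => ?_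
  rw [hG.apply_christoffel hp, christoffelLower_apply, h]
  simp

/-- Differentiate G(Γ(v, w), z) = Γ_lower(v, w, z); the term with the derivative of G drops out at
p. -/
theorem IsMetricOn.apply_fderiv_christoffel (hG : IsMetricOn G U) (hp : p ∈ U)
    (h : fderiv ℝ G p = 0) (x v w z : E) :
    G p (fderiv ℝ (christoffel G) p x v w) z =
      (1 / 2) * (fderiv ℝ (fderiv ℝ G) p x v w z + fderiv ℝ (fderiv ℝ G) p x w v z
        - fderiv ℝ (fderiv ℝ G) p x z v w) := by
  have hGp := ((hG.contDiffAt hp).differentiableAt (by simp)).hasFDerivAt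
  have hΓ := ((hG.contDiffAt_christoffel hp).differentiableAt (by simp)).hasFDerivAt
  have hd : ContDiffAt ℝ ∞ (fderiv ℝ G) p := (hG.contDiffAt hp).fderiv_right (by simp)
  have hH := (hd.differentiableAt (by simp)).hasFDerivAt
  have h1 := (hGp.clm_apply ((hΓ.clm_apply (hasFDerivAt_const v p)).clm_apply
    (hasFDerivAt_const w p))).clm_apply (hasFDerivAt_const z p)
  have h2 : ∀ v w z, HasFDerivAt (fun q => fderiv ℝ G q v w z) _ p := fun v w z =>
    ((hH.clm_apply (hasFDerivAt_const v p)).clm_apply (hasFDerivAt_const w p)).clm_apply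
      (hasFDerivAt_const z p)
  have h3 := (((h2 v w z).add (h2 w v z)).sub (h2 z v w)).const_mul (1 / 2)
  have h4 := h3.congr_of_eventuallyEq (f₁ := fun q => G q (christoffel G q v w) z) (by
    filter_upwards [hG.eventually_mem hp] with q hq
    rw [hG.apply_christoffel hq, christoffelLower_apply]
    rfl)
  have h5 := congrArg (fun l => l x) (h1.unique h4)
  simp [h] at h5
  rw [h5]
  ring

/-- The Jacobi operator at a point where the first derivatives of the metric vanish. -/
theorem IsMetricOn.apply_coordJacobi (hG : IsMetricOn G U) (hp : p ∈ U) (h : fderiv ℝ G p = 0)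
    (v x z : E) : G p (coordJacobi G p v x) z =
      (1 / 2) * (2 * fderiv ℝ (fderiv ℝ G) p x v v z - fderiv ℝ (fderiv ℝ G) p x z v v
        - fderiv ℝ (fderiv ℝ G) p v x v z - fderiv ℝ (fderiv ℝ G) p v v x z
        + fderiv ℝ (fderiv ℝ G) p v z x v) := by
  change G p (curvature G p v x v) z = _
  simp only [curvature, hG.christoffel_eq_zero hp h, map_add, map_sub, map_zero, add_apply,
    sub_apply, hG.apply_fderiv_christoffel hp h]
  simp
  ring

end SemiRiemannian

/-! ### Second-order expansion of the metric at the origin -/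

namespace OP11

open SemiRiemannian

/-- The first derivative in the direction `x` of the numerator of the metric. -/
noncomputable def numDeriv (y x w z : Octonion × Octonion) : ℝ :=
  -(2 * inner ℝ y.2 x.2 * inner ℝ w.1 z.1) - 2 * inner ℝ y.1 x.1 * inner ℝ w.2 z.2
    + inner ℝ ((y.1 * star x.2 + x.1 * star y.2) * w.2) z.1
    + inner ℝ ((y.1 * star x.2 + x.1 * star y.2) * z.2) w.1

/-- The non-constant part of the numerator is quadratic in the base point, so its derivative is
linear there. This gives both the vanishing of the first derivative at 0 and the easy second
derivative. -/
theorem numDeriv_smul (r : ℝ) (y x w z : Octonion × Octonion) :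
    numDeriv (r • y) x w z = r * numDeriv y x w z := by
  simp only [numDeriv, Prod.smul_fst, Prod.smul_snd, Octonion.smul_mul, Octonion.star_smul,
    Octonion.mul_smul, ← smul_add, real_inner_smul_left]
  ring

theorem fderiv_coordMetric {y : Octonion × Octonion} (hy : y ∈ domain)
    (x w z : Octonion × Octonion) : fderiv ℝ coordMetric y x w z =
      numDeriv y x w z / denom y ^ 2 - 2 * coordMetric y w z * fderiv ℝ denom y x / denom y := by
  have hD := (denom_pos hy).ne'
  have h1 : HasFDerivAt (𝕜 := ℝ) (fun y : Octonion × Octonion => y.1) _ y := hasFDerivAt_fst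
  have h2 : HasFDerivAt (𝕜 := ℝ) (fun y : Octonion × Octonion => y.2) _ y := hasFDerivAt_snd
  have hd := ((contDiff_denom (n := 1)).differentiable (by simp) y).hasFDerivAt
  have hG := ((isMetricOn_coordMetric.contDiffAt hy).differentiableAt (by simp)).hasFDerivAt
  -- Metric times squared denominator is polynomial; differentiating this product in two ways avoids
  -- differentiating a quotient.
  have h3 := ((hG.clm_apply (hasFDerivAt_const w y)).clm_apply (hasFDerivAt_const z y)).mul
    (hd.pow 2)
  have hm : ∀ w z : Octonion, HasFDerivAt (𝕜 := ℝ) (fun y : Octonion × Octonion =>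
      (inner ℝ (y.1 * star y.2 * w) z : ℝ)) _ y := fun w z =>
    ((h1.octonion_mul (Octonion.starL.hasFDerivAt.comp y h2)).octonion_mul
      (hasFDerivAt_const w y)).inner ℝ (hasFDerivAt_const z y)
  have h4 := (((h2.norm_sq.const_sub 1).const_mul (inner ℝ w.1 z.1)).sub
    ((h1.norm_sq.const_add 1).const_mul (inner ℝ w.2 z.2))).add ((hm w.2 z.1).add (hm z.2 w.1))
  have h5 := h4.congr_of_eventuallyEq
    (f₁ := (fun q => coordMetric q w z) * fun q => denom q ^ 2) (by
      filter_upwards [isOpen_domain.mem_nhds hy] with q hq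
      have hq' : denom q ≠ 0 := (denom_pos hq).ne'
      simp only [Pi.mul_apply, coordMetric_apply, coordMetricFun, Octonion.re_mul_mul_star]
      rw [← denom]
      field_simp
      rfl)
  have h6 := congrArg (fun l => l x) (h3.unique h5)
  simp [Octonion.mulL_apply, Octonion.starL_apply] at h6
  rw [eq_sub_iff_add_eq, eq_div_iff (pow_ne_zero 2 hD), numDeriv]
  field_simp
  simp only [Octonion.add_mul, inner_add_left] at h6 ⊢
  linarith

theorem zero_mem_domain : (0 : Octonion × Octonion) ∈ domain := by
  simp [domain]

theorem denom_zero : denom 0 = 1 := by simp [denom]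

theorem coordMetric_zero (w z : Octonion × Octonion) :
    coordMetric 0 w z = inner ℝ w.1 z.1 - inner ℝ w.2 z.2 := by
  simp [coordMetric_eq, denom_zero, Octonion.zero_mul, sub_eq_add_neg]

theorem fderiv_coordMetric_zero : fderiv ℝ coordMetric 0 = 0 := by
  refine ContinuousLinearMap.ext fun x => ContinuousLinearMap.ext fun w =>
    ContinuousLinearMap.ext fun z => ?_
  have h := numDeriv_smul 0 0 x w z
  rw [zero_smul, zero_mul] at h
  rw [fderiv_coordMetric zero_mem_domain, h, fderiv_denom]
  simp

theorem fderiv_fderiv_coordMetric_zero (y x w z : Octonion × Octonion) :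
    fderiv ℝ (fderiv ℝ coordMetric) 0 y x w z = numDeriv y x w z
      - 4 * (inner ℝ y.1 x.1 - inner ℝ y.2 x.2) * (inner ℝ w.1 z.1 - inner ℝ w.2 z.2) := by
  have hd : ContDiffAt ℝ ∞ (fderiv ℝ coordMetric) 0 :=
    (isMetricOn_coordMetric.contDiffAt zero_mem_domain).fderiv_right (by simp)
  have hH := (hd.differentiableAt (by simp)).hasFDerivAt
  have h1 := ((hH.clm_apply (hasFDerivAt_const x 0)).clm_apply (hasFDerivAt_const w 0)).clm_apply
    (hasFDerivAt_const z 0)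
  have hline : HasDerivAt (fun s : ℝ => s • y) y 0 := by
    simpa using (hasDerivAt_id (0 : ℝ)).smul_const y
  have h2 := HasFDerivAt.comp_hasDerivAt_of_eq (0 : ℝ) h1 hline (by simp)
  have hden : DifferentiableAt ℝ (fun s : ℝ => denom (s • y)) 0 :=
    ((contDiff_denom (n := 1)).differentiable (by simp) _).comp 0 hline.differentiableAt
  have hG : DifferentiableAt ℝ (fun s : ℝ => coordMetric (s • y) w z) 0 := by
    have h3 : DifferentiableAt ℝ coordMetric ((0 : ℝ) • y) := by
      rw [zero_smul]
      exact (isMetricOn_coordMetric.contDiffAt zero_mem_domain).differentiableAt (by simp)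
    have h4 : DifferentiableAt ℝ (fun s : ℝ => coordMetric (s • y)) 0 :=
      DifferentiableAt.comp (g := coordMetric) 0 h3 hline.differentiableAt
    exact (h4.clm_apply (differentiableAt_const w)).clm_apply (differentiableAt_const z)
  have hd0 : denom ((0 : ℝ) • y) ≠ 0 := by simp [denom_zero]
  have hd0' : denom ((0 : ℝ) • y) ^ 2 ≠ 0 := pow_ne_zero 2 hd0
  have hg : DifferentiableAt ℝ (fun s : ℝ => numDeriv y x w z / denom (s • y) ^ 2
      - 4 * (inner ℝ y.1 x.1 - inner ℝ y.2 x.2) * coordMetric (s • y) w z / denom (s • y)) 0 :=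
    ((differentiableAt_const _).div (hden.pow 2) hd0').sub ((hG.const_mul _).div hden hd0)
  -- Along the line s ↦ s y the first derivative of the metric has the form s · g(s), so its
  -- derivative at 0 is g(0), and g' is never computed.
  have h5 := (hasDerivAt_id (0 : ℝ)).mul hg.hasDerivAt
  have h6 := h5.congr_of_eventuallyEq (f₁ := fun s : ℝ => fderiv ℝ coordMetric (s • y) x w z) (by
    have hc : ContinuousAt (fun s : ℝ => s • y) 0 := hline.continuousAt
    filter_upwards [hc.eventually (isOpen_domain.mem_nhds
      (by simpa using zero_mem_domain))] with s hs
    have hs' := (denom_pos hs).ne'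
    simp only [Pi.mul_apply, id]
    rw [fderiv_coordMetric hs, numDeriv_smul, fderiv_denom]
    simp only [Prod.smul_fst, Prod.smul_snd, real_inner_smul_left]
    field_simp
    ring)
  have h7 := h2.unique h6
  simp [denom_zero, coordMetric_zero] at h7
  exact h7

/-- The Jacobi operator at the origin. -/
theorem coordJacobi_zero (v x : Octonion × Octonion) :
    coordJacobi coordMetric 0 v x =
      (4 : ℝ) • (coordMetric 0 v v • x - coordMetric 0 v x • v) + (3 : ℝ) •
        (‖v.2‖ ^ 2 • x.1 - v.1 * star v.2 * x.2, v.2 * star v.1 * x.1 - ‖v.1‖ ^ 2 • x.2) := by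
  rw [← sub_eq_zero]
  refine coordMetric_nondegenerate zero_mem_domain _ fun z => ?_
  rw [map_sub, sub_apply,
    isMetricOn_coordMetric.apply_coordJacobi zero_mem_domain fderiv_coordMetric_zero]
  simp only [fderiv_fderiv_coordMetric_zero, numDeriv, coordMetric_zero]
  obtain ⟨a, b⟩ := v
  obtain ⟨c, d⟩ := x
  obtain ⟨e, f⟩ := z
  -- The rules `k1`–`k4` reduce every quadrilinear term that occurs to ⟨(a b̄)d, e⟩, ⟨(b ā)c, f⟩ and
  -- products of inner products. What remains is commutative algebra.
  have k1 : ∀ p q r s : Octonion, inner ℝ (p * star q * r) s = inner ℝ (s * star r * q) p := by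
    intro p q r s
    rw [Octonion.inner_mul_right, Octonion.inner_mul_right, Octonion.star_star', real_inner_comm]
  have k2 : ∀ p q r s : Octonion, inner ℝ (p * star q * r) s = inner ℝ (q * star p * s) r := by
    intro p q r s
    rw [Octonion.inner_mul_left, Octonion.star_mul', Octonion.star_star', real_inner_comm]
  have k3 : ∀ p q r s : Octonion, inner ℝ (p * star q * r) s =
      2 * inner ℝ q r * inner ℝ p s - inner ℝ (p * star r * q) s := by
    intro p q r s
    have h := congrArg (fun t => inner ℝ t s) (Octonion.mul_star_mul_add p q r)
    simp only [inner_add_left, real_inner_smul_left] at h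
    linarith
  have k4 : ∀ p q s : Octonion, inner ℝ (p * star q * q) s = ‖q‖ ^ 2 * inner ℝ p s := by
    intro p q s
    rw [Octonion.mul_star_mul, real_inner_smul_left]
  have t1 : inner ℝ (a * star d * b) e = 2 * inner ℝ d b * inner ℝ a e
      - inner ℝ (a * star b * d) e := k3 _ _ _ _
  have t2 : inner ℝ (c * star b * f) a = 2 * inner ℝ a c * inner ℝ b f
      - inner ℝ (b * star a * c) f := by
    rw [k2, k3, real_inner_comm]
  have t3 : inner ℝ (a * star d * f) a = ‖a‖ ^ 2 * inner ℝ d f := by rw [k2, k4]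
  have t4 : inner ℝ (c * star f * b) a = inner ℝ (b * star a * c) f := by
    rw [k1, k2]
  have t5 : inner ℝ (e * star d * b) a = inner ℝ (a * star b * d) e := k1 _ _ _ _
  have t6 : inner ℝ (a * star b * f) c = inner ℝ (b * star a * c) f := k2 _ _ _ _
  have t7 : inner ℝ (a * star f * d) a = ‖a‖ ^ 2 * inner ℝ d f := by rw [k1, t3]
  have t8 : inner ℝ (a * star f * b) c = 2 * inner ℝ a c * inner ℝ b f
      - inner ℝ (b * star a * c) f := by rw [k1, t2]
  have t9 : inner ℝ (e * star b * d) a = 2 * inner ℝ d b * inner ℝ a e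
      - inner ℝ (a * star b * d) e := by rw [k1, t1]
  have t10 : inner ℝ (e * star b * b) c = ‖b‖ ^ 2 * inner ℝ c e := by rw [k4, real_inner_comm]
  simp only [Octonion.add_mul, inner_add_left, inner_sub_left, real_inner_smul_left, t1, t2, t3,
    t4, t5, t6, t7, t8, t9, t10, k4, Prod.fst_add, Prod.snd_add, Prod.fst_sub, Prod.snd_sub,
    Prod.smul_fst, Prod.smul_snd, real_inner_self_eq_norm_sq, real_inner_comm a c,
    real_inner_comm b d]
  ring

end OP11

namespace OP11

open SemiRiemannian

/-! ### Eigenspaces of the Jacobi operator at the origin -/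

/-- The part of the Jacobi operator at the origin that vanishes on the octonionic line through
`v`. -/
noncomputable def defect (v x : Octonion × Octonion) : Octonion × Octonion :=
  (‖v.2‖ ^ 2 • x.1 - v.1 * star v.2 * x.2, v.2 * star v.1 * x.1 - ‖v.1‖ ^ 2 • x.2)

variable {v w x : Octonion × Octonion}

theorem defect_add_smul (v x y : Octonion × Octonion) (r : ℝ) :
    defect v (x + r • y) = defect v x + r • defect v y := by
  simp only [defect, Prod.fst_add, Prod.snd_add, Prod.smul_fst, Prod.smul_snd, Octonion.mul_add,
    Octonion.mul_smul, Prod.smul_mk, Prod.mk_add_mk, Prod.mk.injEq]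
  constructor <;> module

theorem defect_self (v : Octonion × Octonion) : defect v v = 0 := by
  simp only [defect, Octonion.mul_star_mul, sub_self]
  rfl

theorem coordMetric_zero_self (v : Octonion × Octonion) :
    coordMetric 0 v v = ‖v.1‖ ^ 2 - ‖v.2‖ ^ 2 := by
  rw [coordMetric_zero, real_inner_self_eq_norm_sq, real_inner_self_eq_norm_sq]

theorem mul_star_mul_mul (a b x : Octonion) :
    a * star b * (b * star a * x) = (‖a‖ ^ 2 * ‖b‖ ^ 2) • x := by
  have h := Octonion.mul_star_mul' (a * star b) x
  rwa [Octonion.star_mul', Octonion.star_star', Octonion.norm_mul, Octonion.norm_star,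
    mul_pow] at h

/-- The matrix of `defect v` has trace |b|² - |a|² = -ε, and its determinant vanishes because a b̄
times its conjugate acts as |a|²|b|². So -ε⁻¹ times it is a projection if ε ≠ 0. -/
theorem defect_defect (v x : Octonion × Octonion) :
    defect v (defect v x) = (-coordMetric 0 v v) • defect v x := by
  rw [coordMetric_zero_self]
  simp only [defect, sub_eq_add_neg, ← neg_one_smul ℝ (_ : Octonion), Octonion.mul_add,
    Octonion.mul_smul, mul_star_mul_mul, Prod.smul_mk, Prod.mk.injEq]
  constructor <;> module

theorem coordMetric_zero_defect (v x : Octonion × Octonion) :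
    coordMetric 0 v (defect v x) = 0 := by
  have h : ∀ a b c : Octonion, inner ℝ a (a * star b * c) = ‖a‖ ^ 2 * inner ℝ b c := by
    intro a b c
    rw [real_inner_comm, Octonion.inner_mul_left, Octonion.star_mul', Octonion.star_star',
      Octonion.mul_star_mul, real_inner_smul_right, real_inner_comm]
  simp only [coordMetric_zero, defect, inner_sub_right, real_inner_smul_right, h]
  ring

theorem coordJacobi_zero_eq (v x : Octonion × Octonion) : coordJacobi coordMetric 0 v x =
    (4 * coordMetric 0 v v) • x - (4 * coordMetric 0 v x) • v + (3 : ℝ) • defect v x := by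
  rw [coordJacobi_zero, defect]
  module

theorem coordMetric_zero_coordJacobi (v x : Octonion × Octonion) :
    coordMetric 0 v (coordJacobi coordMetric 0 v x) = 0 := by
  rw [coordJacobi_zero_eq, map_add, map_sub, map_smul, map_smul, map_smul,
    coordMetric_zero_defect]
  simp only [smul_eq_mul]
  ring

theorem coordJacobi_zero_eq_four_iff (hv : coordMetric 0 v v ≠ 0) :
    coordJacobi coordMetric 0 v x = (coordMetric 0 v v * 4) • x ↔
      coordMetric 0 v x = 0 ∧ defect v x = 0 := by
  constructor
  · intro h
    have h1 := coordMetric_zero_coordJacobi v x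
    rw [h, map_smul, smul_eq_mul, mul_eq_zero, or_iff_right (by positivity)] at h1
    refine ⟨h1, ?_⟩
    rw [coordJacobi_zero_eq, h1, mul_zero, zero_smul, sub_zero, mul_comm, add_eq_left] at h
    exact (smul_eq_zero_iff_right (by norm_num)).1 h
  · rintro ⟨h1, h2⟩
    rw [coordJacobi_zero_eq, h1, h2]
    module

/-- Orthogonality to v need not be assumed on either side: both 𝒥_v and `defect v` have image in
v^⊥, so it follows from either equation when ε ≠ 0. -/
theorem coordJacobi_zero_eq_one_iff (hv : coordMetric 0 v v ≠ 0) :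
    coordJacobi coordMetric 0 v x = (coordMetric 0 v v * 1) • x ↔
      defect v x = (-coordMetric 0 v v) • x := by
  constructor
  · intro h
    have h1 := coordMetric_zero_coordJacobi v x
    rw [h, map_smul, smul_eq_mul, mul_eq_zero, or_iff_right (by simpa using hv)] at h1
    rw [coordJacobi_zero_eq, h1, ← sub_eq_zero] at h
    have h2 : (3 : ℝ) • (defect v x - (-coordMetric 0 v v) • x) = 0 := by
      refine Eq.trans ?_ h
      module
    exact sub_eq_zero.1 ((smul_eq_zero_iff_right (by norm_num)).1 h2)
  · intro h
    have h1 := coordMetric_zero_defect v x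
    rw [h, map_smul, smul_eq_mul, mul_eq_zero, or_iff_right (by simpa using hv)] at h1
    rw [coordJacobi_zero_eq, h1, h]
    module

theorem smul_eq_iff_eq_div_smul {r : ℝ} (hr : r ≠ 0) {x y : Octonion} :
    r • x = y ↔ x = (1 / r) • y := by
  constructor
  · rintro rfl
    rw [smul_smul, one_div, inv_mul_cancel₀ hr, one_smul]
  · rintro rfl
    rw [smul_smul, mul_one_div_cancel hr, one_smul]

/-- When a ≠ 0 the second component of the equation implies the first, after multiplication by a b̄
and cancellation of |a|². -/
theorem defect_eq_zero_iff_of_fst (ha : v.1 ≠ 0) :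
    defect v x = 0 ↔ x.2 = (1 / ‖v.1‖ ^ 2) • (v.2 * star v.1 * x.1) := by
  have hn : ‖v.1‖ ^ 2 ≠ 0 := pow_ne_zero 2 (norm_ne_zero_iff.2 ha)
  constructor
  · intro h
    have h2 : v.2 * star v.1 * x.1 - ‖v.1‖ ^ 2 • x.2 = 0 := congrArg Prod.snd h
    rw [← smul_eq_iff_eq_div_smul hn, sub_eq_zero.1 h2]
  · intro h
    rw [← smul_eq_iff_eq_div_smul hn] at h
    refine Prod.ext ?_ ?_
    · have h3 := mul_star_mul_mul v.1 v.2 x.1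
      rw [← h, Octonion.mul_smul, ← smul_smul] at h3
      have h4 := smul_right_injective _ hn h3
      simp only [defect, h4, sub_self]
      rfl
    · simp only [defect, h, sub_self]
      rfl

theorem defect_eq_zero_iff_of_snd (hb : v.2 ≠ 0) :
    defect v x = 0 ↔ x.1 = (1 / ‖v.2‖ ^ 2) • (v.1 * star v.2 * x.2) := by
  have hn : ‖v.2‖ ^ 2 ≠ 0 := pow_ne_zero 2 (norm_ne_zero_iff.2 hb)
  constructor
  · intro h
    have h2 : ‖v.2‖ ^ 2 • x.1 - v.1 * star v.2 * x.2 = 0 := congrArg Prod.fst h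
    rw [← smul_eq_iff_eq_div_smul hn, sub_eq_zero.1 h2]
  · intro h
    rw [← smul_eq_iff_eq_div_smul hn] at h
    refine Prod.ext ?_ ?_
    · simp only [defect, h, sub_self]
      rfl
    · have h3 := mul_star_mul_mul v.2 v.1 x.2
      rw [← h, Octonion.mul_smul, ← smul_smul] at h3
      have h4 := smul_right_injective _ hn h3
      simp only [defect, h4, sub_self]
      rfl

theorem defect_eq_neg_smul_iff :
    defect v x = (-coordMetric 0 v v) • x ↔
      v.1 * star v.2 * x.2 = ‖v.1‖ ^ 2 • x.1 ∧ v.2 * star v.1 * x.1 = ‖v.2‖ ^ 2 • x.2 := by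
  rw [coordMetric_zero_self, Prod.ext_iff]
  simp only [defect, Prod.smul_fst, Prod.smul_snd]
  refine and_congr ?_ ?_ <;> rw [← sub_eq_zero, ← sub_eq_zero (b := _ • _)]
  · rw [← neg_eq_zero]
    refine Eq.congr_left ?_
    module
  · refine Eq.congr_left ?_
    module

theorem defect_eq_neg_smul_iff_of_fst (ha : v.1 ≠ 0) :
    defect v x = (-coordMetric 0 v v) • x ↔ x.1 = (1 / ‖v.1‖ ^ 2) • (v.1 * star v.2 * x.2) := by
  have hn : ‖v.1‖ ^ 2 ≠ 0 := pow_ne_zero 2 (norm_ne_zero_iff.2 ha)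
  rw [defect_eq_neg_smul_iff, ← smul_eq_iff_eq_div_smul hn, eq_comm, and_iff_left_iff_imp]
  intro h
  have h3 := mul_star_mul_mul v.2 v.1 x.2
  rw [← h, Octonion.mul_smul, mul_comm, ← smul_smul] at h3
  exact smul_right_injective _ hn h3

theorem defect_eq_neg_smul_iff_of_snd (hb : v.2 ≠ 0) :
    defect v x = (-coordMetric 0 v v) • x ↔ x.2 = (1 / ‖v.2‖ ^ 2) • (v.2 * star v.1 * x.1) := by
  have hn : ‖v.2‖ ^ 2 ≠ 0 := pow_ne_zero 2 (norm_ne_zero_iff.2 hb)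
  rw [defect_eq_neg_smul_iff, ← smul_eq_iff_eq_div_smul hn, eq_comm (a := _ • x.2),
    and_iff_right_iff_imp]
  intro h
  have h3 := mul_star_mul_mul v.1 v.2 x.1
  rw [h, Octonion.mul_smul, mul_comm, ← smul_smul] at h3
  exact smul_right_injective _ hn h3

theorem mul_star_mul_star (a b c : Octonion) :
    (a * star b * c) * star c = ‖c‖ ^ 2 • (a * star b) := Octonion.mul_mul_star _ _

/-- Membership in the octonionic line through `v` is symmetric and transitive. -/
theorem defect_eq_zero_congr (hv : v ≠ 0) (hw : w ≠ 0) (h : defect v w = 0) :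
    defect v x = 0 ↔ defect w x = 0 := by
  -- A line that is not vertical is determined by its slope b ā / |a|². If d = (b ā)c / |a|², then d
  -- c̄ / |c|² is the same slope by alternativity; the roles of the coordinates are exchanged when a
  -- = 0.
  by_cases ha : v.1 = 0
  · have hb : v.2 ≠ 0 := fun hb => hv (Prod.ext ha hb)
    have hd : w.2 ≠ 0 := by
      intro hd
      rw [defect_eq_zero_iff_of_snd hb, hd, Octonion.mul_zero, smul_zero] at h
      exact hw (Prod.ext h hd)
    have hn : ‖w.2‖ ^ 2 ≠ 0 := pow_ne_zero 2 (norm_ne_zero_iff.2 hd)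
    rw [defect_eq_zero_iff_of_snd hb] at h
    rw [defect_eq_zero_iff_of_snd hb, defect_eq_zero_iff_of_snd hd, h, Octonion.smul_mul,
      mul_star_mul_star, Octonion.smul_mul, Octonion.smul_mul, smul_comm (1 / ‖v.2‖ ^ 2), smul_smul,
      one_div_mul_cancel hn, one_smul]
  · have hc : w.1 ≠ 0 := by
      intro hc
      rw [defect_eq_zero_iff_of_fst ha, hc, Octonion.mul_zero, smul_zero] at h
      exact hw (Prod.ext hc h)
    have hn : ‖w.1‖ ^ 2 ≠ 0 := pow_ne_zero 2 (norm_ne_zero_iff.2 hc)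
    rw [defect_eq_zero_iff_of_fst ha] at h
    rw [defect_eq_zero_iff_of_fst ha, defect_eq_zero_iff_of_fst hc, h, Octonion.smul_mul,
      mul_star_mul_star, Octonion.smul_mul, Octonion.smul_mul, smul_comm (1 / ‖v.1‖ ^ 2), smul_smul,
      one_div_mul_cancel hn, one_smul]

/-- Taking norms gives |b||d| = |a||c|, and multiplying by d̄ on the right gives |a|² c d̄ = |d|² a
b̄. Multiplying this by b, and its conjugate by a, yields the two equations with the vectors
exchanged. -/
theorem mul_star_mul_eq_of_mul_star_mul_eq {a b c d : Octonion} (ha : a ≠ 0)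
    (h : a * star b * d = ‖a‖ ^ 2 • c) :
    c * star d * b = ‖c‖ ^ 2 • a ∧ d * star c * a = ‖d‖ ^ 2 • b := by
  have ha' : ‖a‖ ≠ 0 := norm_ne_zero_iff.2 ha
  have hn : ‖a‖ ^ 2 ≠ 0 := pow_ne_zero 2 ha'
  have h1 : ‖b‖ * ‖d‖ = ‖a‖ * ‖c‖ := by
    have h2 := congrArg norm h
    rw [Octonion.norm_mul, Octonion.norm_mul, Octonion.norm_star, norm_smul,
      Real.norm_of_nonneg (sq_nonneg _)] at h2
    refine mul_left_cancel₀ ha' ?_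
    linarith
  have h2 : ‖a‖ ^ 2 • (c * star d) = ‖d‖ ^ 2 • (a * star b) := by
    rw [← Octonion.smul_mul, ← h, mul_star_mul_star]
  have h3 : ‖a‖ ^ 2 • (d * star c) = ‖d‖ ^ 2 • (b * star a) := by
    have h4 := congrArg star h2
    simpa only [Octonion.star_smul, Octonion.star_mul', Octonion.star_star'] using h4
  constructor
  · refine smul_right_injective _ hn ?_
    change ‖a‖ ^ 2 • (c * star d * b) = ‖a‖ ^ 2 • (‖c‖ ^ 2 • a)
    rw [← Octonion.smul_mul, h2, Octonion.smul_mul, Octonion.mul_star_mul, smul_smul, smul_smul,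
      ← mul_pow, ← mul_pow, mul_comm ‖d‖, h1]
  · refine smul_right_injective _ hn ?_
    change ‖a‖ ^ 2 • (d * star c * a) = ‖a‖ ^ 2 • (‖d‖ ^ 2 • b)
    rw [← Octonion.smul_mul, h3, Octonion.smul_mul, Octonion.mul_star_mul, smul_comm]

/-- The core of condition III. Here w may be null or zero, as that condition requires. -/
theorem defect_swap (hv : v ≠ 0) (h : defect v w = (-coordMetric 0 v v) • w) :
    defect w v = (-coordMetric 0 w w) • v := by
  rw [defect_eq_neg_smul_iff] at h ⊢
  by_cases ha : v.1 = 0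
  · have hb : v.2 ≠ 0 := fun hb => hv (Prod.ext ha hb)
    exact (mul_star_mul_eq_of_mul_star_mul_eq hb h.2).symm
  · exact mul_star_mul_eq_of_mul_star_mul_eq ha h.1

/-- On the octonionic line through v = (a, b) one has |a|² g(v, x) = ε ⟨x₁, a⟩, so g-orthogonality
to v is Euclidean orthogonality of first components. -/
theorem coordMetric_zero_eq_zero_iff_of_fst (hv : coordMetric 0 v v ≠ 0) (ha : v.1 ≠ 0)
    (h : defect v x = 0) : coordMetric 0 v x = 0 ↔ inner ℝ x.1 v.1 = 0 := by
  have hn : ‖v.1‖ ^ 2 ≠ 0 := pow_ne_zero 2 (norm_ne_zero_iff.2 ha)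
  have h1 : ‖v.1‖ ^ 2 * coordMetric 0 v x = coordMetric 0 v v * inner ℝ x.1 v.1 := by
    rw [defect_eq_zero_iff_of_fst ha] at h
    rw [coordMetric_zero_self, coordMetric_zero, h, real_inner_smul_right, real_inner_comm _ v.2,
      Octonion.inner_mul_left, Octonion.star_mul', Octonion.star_star', Octonion.mul_star_mul,
      real_inner_smul_right, real_inner_comm v.1]
    field_simp
  constructor
  · intro h2
    rw [h2, mul_zero] at h1
    exact (mul_eq_zero.1 h1.symm).resolve_left hv
  · intro h2
    rw [h2, mul_zero] at h1
    exact (mul_eq_zero.1 h1).resolve_left hn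

theorem coordMetric_zero_eq_zero_iff_of_snd (hv : coordMetric 0 v v ≠ 0) (hb : v.2 ≠ 0)
    (h : defect v x = 0) : coordMetric 0 v x = 0 ↔ inner ℝ x.2 v.2 = 0 := by
  have hn : ‖v.2‖ ^ 2 ≠ 0 := pow_ne_zero 2 (norm_ne_zero_iff.2 hb)
  have h1 : ‖v.2‖ ^ 2 * coordMetric 0 v x = coordMetric 0 v v * inner ℝ x.2 v.2 := by
    rw [defect_eq_zero_iff_of_snd hb] at h
    rw [coordMetric_zero_self, coordMetric_zero, h, real_inner_smul_right, real_inner_comm _ v.1,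
      Octonion.inner_mul_left, Octonion.star_mul', Octonion.star_star', Octonion.mul_star_mul,
      real_inner_smul_right, real_inner_comm v.2]
    field_simp
  constructor
  · intro h2
    rw [h2, mul_zero] at h1
    exact (mul_eq_zero.1 h1.symm).resolve_left hv
  · intro h2
    rw [h2, mul_zero] at h1
    exact (mul_eq_zero.1 h1).resolve_left hn

theorem ne_zero_of_coordMetric_zero (hv : coordMetric 0 v v ≠ 0) : v ≠ 0 := by
  rintro rfl
  simp at hv

theorem coordJacobi_zero_four_iff_of_fst (hv : coordMetric 0 v v ≠ 0) (ha : v.1 ≠ 0) :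
    coordJacobi coordMetric 0 v x = (coordMetric 0 v v * 4) • x ↔
      inner ℝ x.1 v.1 = 0 ∧ x.2 = (1 / ‖v.1‖ ^ 2) • (v.2 * star v.1 * x.1) := by
  rw [coordJacobi_zero_eq_four_iff hv, ← defect_eq_zero_iff_of_fst ha]
  exact and_congr_left fun h => coordMetric_zero_eq_zero_iff_of_fst hv ha h

theorem coordJacobi_zero_four_iff_of_snd (hv : coordMetric 0 v v ≠ 0) (hb : v.2 ≠ 0) :
    coordJacobi coordMetric 0 v x = (coordMetric 0 v v * 4) • x ↔
      inner ℝ x.2 v.2 = 0 ∧ x.1 = (1 / ‖v.2‖ ^ 2) • (v.1 * star v.2 * x.2) := by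
  rw [coordJacobi_zero_eq_four_iff hv, ← defect_eq_zero_iff_of_snd hb]
  exact and_congr_left fun h => coordMetric_zero_eq_zero_iff_of_snd hv hb h

end OP11

/-! ### Dimension counts -/

theorem Submodule.finrank_eq_of_map {V W : Type*} [AddCommGroup V] [Module ℝ V] [AddCommGroup W]
    [Module ℝ W] {S : Submodule ℝ V} {T : Submodule ℝ W} (f : V →ₗ[ℝ] W)
    (hinj : ∀ x ∈ S, f x = 0 → x = 0) (hmap : ∀ x ∈ S, f x ∈ T)
    (hsurj : ∀ y ∈ T, ∃ x ∈ S, f x = y) : Module.finrank ℝ S = Module.finrank ℝ T := by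
  refine (LinearEquiv.ofBijective (f.restrict hmap) ⟨?_, ?_⟩).finrank_eq
  · rw [injective_iff_map_eq_zero]
    intro x hx
    exact Subtype.ext (hinj x x.2 (congrArg Subtype.val hx))
  · rintro ⟨y, hy⟩
    obtain ⟨x, hx, rfl⟩ := hsurj y hy
    exact ⟨⟨x, hx⟩, rfl⟩

namespace Octonion

theorem finrank_eq : Module.finrank ℝ Octonion = 8 := by
  rw [equivProd.finrank_eq, Module.finrank_prod, Quaternion.finrank_eq_four]

theorem finrank_orthogonal {a : Octonion} (ha : a ≠ 0) :
    Module.finrank ℝ (Submodule.span ℝ {a})ᗮ = 7 := by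
  have : Fact (Module.finrank ℝ Octonion = 7 + 1) := ⟨finrank_eq⟩
  exact Submodule.finrank_orthogonal_span_singleton ha

end Octonion

/-! ### Locality of curvature and of isometries -/

namespace SemiRiemannian

section Coordinates

variable {E : Type*} [NormedAddCommGroup E] [NormedSpace ℝ E]
  {G G' : E → E →L[ℝ] E →L[ℝ] ℝ} {φ ψ : E → E} {p : E}

theorem christoffel_congr (h : G =ᶠ[nhds p] G') : christoffel G =ᶠ[nhds p] christoffel G' := by
  filter_upwards [h, h.fderiv (𝕜 := ℝ)] with q h1 h2
  rw [christoffel, christoffel, christoffelLower, christoffelLower, h1, h2]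

theorem coordJacobi_congr (h : G =ᶠ[nhds p] G') : coordJacobi G p = coordJacobi G' p := by
  ext v x
  change curvature G p v x v = curvature G' p v x v
  have h1 := christoffel_congr h
  rw [curvature, curvature, h1.fderiv_eq, h1.self_of_nhds]

theorem IsLocalIsometryAt.congr (h : IsLocalIsometryAt G φ p) (hψ : ψ =ᶠ[nhds p] φ) :
    IsLocalIsometryAt G ψ p := by
  refine ⟨h.smooth.congr_of_eventuallyEq hψ, ?_⟩
  filter_upwards [h.isometric, hψ, hψ.fderiv (𝕜 := ℝ)] with q h1 h2 h3
  rw [h2, h3]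
  exact h1

theorem isLocalIsometryAt_id (G : E → E →L[ℝ] E →L[ℝ] ℝ) (p : E) :
    IsLocalIsometryAt G id p :=
  ⟨contDiffAt_id, Filter.Eventually.of_forall fun q v w => by simp⟩

end Coordinates

end SemiRiemannian

namespace OP11

open SemiRiemannian

/-! ### The metric in charts -/

theorem target_eq_domain {e : OpenPartialHomeomorph OP11 (Octonion × Octonion)}
    (he : e ∈ atlas (Octonion × Octonion) OP11) : e.target = domain := by
  change e ∈ ({chart₁, chart₂} : Set _) at he
  rcases he with rfl | rfl <;> rfl

/-- Changes of charts are isometries. -/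
theorem isLocalIsometryAt_coordChange {e e' : OpenPartialHomeomorph OP11 (Octonion × Octonion)}
    (he : e ∈ atlas (Octonion × Octonion) OP11) (he' : e' ∈ atlas (Octonion × Octonion) OP11)
    {y : Octonion × Octonion} (hy : y ∈ (e.symm ≫ₕ e').source) :
    IsLocalIsometryAt coordMetric (e' ∘ e.symm) y := by
  have hopen : (e.symm ≫ₕ e').source ∈ nhds y := (e.symm ≫ₕ e').open_source.mem_nhds hy
  have hid : ∀ e : OpenPartialHomeomorph OP11 (Octonion × Octonion), y ∈ e.target →
      IsLocalIsometryAt coordMetric (e ∘ e.symm) y := fun e hy =>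
    (isLocalIsometryAt_id coordMetric y).congr (by
      filter_upwards [e.open_target.mem_nhds hy] with q hq
      exact e.right_inv hq)
  change e ∈ ({chart₁, chart₂} : Set _) at he
  change e' ∈ ({chart₁, chart₂} : Set _) at he'
  rcases he with rfl | rfl <;> rcases he' with rfl | rfl
  · exact hid _ hy.1
  · refine (isLocalIsometryAt_transition hy.1 (fst_ne_zero_of_swapFun_mem hy.1 hy.2)).congr ?_
    filter_upwards [hopen] with q hq
    exact coord₁_swapFun_coordInv₁ hq.1
  · refine (isLocalIsometryAt_transition hy.1 (fst_ne_zero_of_swapFun_mem hy.1 hy.2)).congr ?_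
    filter_upwards [hopen] with q hq
    exact coord₁_swapFun_coordInv₁ hq.1
  · exact hid _ hy.1

theorem mfderiv_chart {e : OpenPartialHomeomorph OP11 (Octonion × Octonion)}
    (he : e ∈ atlas (Octonion × Octonion) OP11) {p : OP11} (hp : p ∈ e.source) :
    mfderiv 𝓘(ℝ, Octonion × Octonion) 𝓘(ℝ, Octonion × Octonion) e p =
      fderiv ℝ (e ∘ (chartAt (Octonion × Octonion) p).symm) (chartAt (Octonion × Octonion) p p) := by
  have h : MDifferentiableAt 𝓘(ℝ, Octonion × Octonion) 𝓘(ℝ, Octonion × Octonion) e p :=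
    mdifferentiableAt_atlas he hp
  refine h.mfderiv.trans ?_
  rw [modelWithCornersSelf_coe, Set.range_id, fderivWithin_univ]
  rfl

/-- The metric is defined in the preferred chart at p; passing from there to the chart e is an
isometry of the coordinate formula. -/
theorem metric_eq_coordMetric {e : OpenPartialHomeomorph OP11 (Octonion × Octonion)}
    (he : e ∈ atlas (Octonion × Octonion) OP11) {p : OP11} (hp : p ∈ e.source)
    (v w : TangentSpace 𝓘(ℝ, Octonion × Octonion) p) :
    metric p v w = coordMetric (e p)
      (mfderiv 𝓘(ℝ, Octonion × Octonion) 𝓘(ℝ, Octonion × Octonion) e p v)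
      (mfderiv 𝓘(ℝ, Octonion × Octonion) 𝓘(ℝ, Octonion × Octonion) e p w) := by
  rw [mfderiv_chart he hp]
  set c := chartAt (Octonion × Octonion) p with hc
  have hpc : p ∈ c.source := mem_chart_source _ p
  have hy : c p ∈ (c.symm ≫ₕ e).source := by
    refine ⟨c.map_source hpc, ?_⟩
    change c.symm (c p) ∈ e.source
    rwa [c.left_inv hpc]
  have h := (isLocalIsometryAt_coordChange (chart_mem_atlas _ p) he hy).isometric.self_of_nhds v w
  have h' : (e ∘ c.symm) (c p) = e p := congrArg e (c.left_inv hpc)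
  rw [h'] at h
  exact h

/-- The preferred chart may change from point to point inside one chart domain, but coordinate
changes are isometries, so a single formula holds on the whole target. -/
theorem inChart_metric {x : OP11} {y : Octonion × Octonion}
    (hy : y ∈ (chartAt (Octonion × Octonion) x).target) : inChart metric x y = coordMetric y := by
  set c := chartAt (Octonion × Octonion) x with hc
  set q : OP11 := c.symm y with hq
  set c' := chartAt (Octonion × Octonion) q with hc'
  have hcq : c q = y := c.right_inv hy
  have hy' : y ∈ (c.symm ≫ₕ c').source := ⟨hy, mem_chart_source _ q⟩
  have h := (isLocalIsometryAt_coordChange (chart_mem_atlas _ x) (chart_mem_atlas _ q)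
    hy').isometric.self_of_nhds
  have ht : tangentCoordChange 𝓘(ℝ, Octonion × Octonion) x q q = fderiv ℝ (c' ∘ c.symm) y := by
    rw [tangentCoordChange_def]
    simp only [modelWithCornersSelf_coe, Set.range_id, fderivWithin_univ]
    rw [← hcq]
    rfl
  refine ContinuousLinearMap.ext fun v => ContinuousLinearMap.ext fun w => ?_
  rw [h v w, ← ht]
  rfl

theorem isMetric_metric : IsMetric metric where
  symm p v w := coordMetric_symm _ v w
  nondegenerate p v h := by
    refine coordMetric_nondegenerate ?_ v h
    rw [← target_eq_domain (chart_mem_atlas (Octonion × Octonion) p)]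
    exact mem_chart_target _ p
  smooth x := by
    refine ContDiffOn.congr ?_ fun y hy => inChart_metric hy
    rw [target_eq_domain (chart_mem_atlas (Octonion × Octonion) x)]
    exact contDiffOn_coordMetric

theorem jacobi_metric (p : OP11) (v : TangentSpace 𝓘(ℝ, Octonion × Octonion) p) :
    jacobi metric p v = coordJacobi coordMetric (chartAt (Octonion × Octonion) p p) v := by
  have h : inChart metric p =ᶠ[nhds (chartAt (Octonion × Octonion) p p)] coordMetric := by
    filter_upwards [(chartAt (Octonion × Octonion) p).open_target.mem_nhds
      (mem_chart_target _ p)] with y hy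
    exact inChart_metric hy
  rw [jacobi, coordJacobi_congr h]

/-! ### Reduction of every tangent space to the origin -/

/-- The linear isomorphism `L` identifies the metric and the Jacobi operators at `p` with those at
the origin of the affine plane. -/
structure IsModel (p : OP11)
    (L : TangentSpace 𝓘(ℝ, Octonion × Octonion) p ≃ₗ[ℝ] Octonion × Octonion) : Prop where
  metric_eq : ∀ v w, metric p v w = coordMetric 0 (L v) (L w)
  jacobi_eq : ∀ v x, L (jacobi metric p v x) = coordJacobi coordMetric 0 (L v) (L x)

/-- The differential of a local isometry carrying the coordinates of p to 0 serves as L. -/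
theorem exists_isModel (p : OP11) : ∃ L, IsModel p L := by
  set y := chartAt (Octonion × Octonion) p p with hy
  have hyd : y ∈ domain := by
    rw [← target_eq_domain (chart_mem_atlas (Octonion × Octonion) p)]
    exact mem_chart_target _ p
  obtain ⟨φ, hφ, hφ0⟩ := exists_isLocalIsometryAt hyd
  have hφd : φ y ∈ domain := by
    rw [hφ0]
    exact zero_mem_domain
  have hinj := hφ.fderiv_injective isMetricOn_coordMetric hyd
  have hsurj := hφ.fderiv_surjective isMetricOn_coordMetric hyd
  refine ⟨LinearEquiv.ofBijective (fderiv ℝ φ y).toLinearMap ⟨hinj, hsurj⟩, ?_, ?_⟩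
  · intro v w
    have h := hφ.isometric.self_of_nhds v w
    rw [hφ0] at h
    exact h
  · intro v x
    have h := hφ.fderiv_curvature isMetricOn_coordMetric hyd hφd v x v
    rw [hφ0] at h
    rw [jacobi_metric]
    exact h

theorem chartAt_basePoint_apply : chartAt (Octonion × Octonion) basePoint basePoint = 0 := by
  rw [chartAt_basePoint]
  exact chart₁_apply 0 0 ⟨rfl, by simp⟩

/-- The explicit eigenspaces are stated in the coordinates of the first chart, so an unspecified
model would not do here. -/
theorem isModel_basePoint : IsModel basePoint (LinearEquiv.refl ℝ (Octonion × Octonion)) where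
  metric_eq v w := by
    rw [metric, chartAt_basePoint_apply]
    rfl
  jacobi_eq v x := by
    rw [jacobi_metric, chartAt_basePoint_apply]
    rfl

theorem tangentCoord_apply (v : TangentSpace 𝓘(ℝ, Octonion × Octonion) basePoint) :
    tangentCoord v = v := by
  have hs : basePoint ∈ chart₁.source := toPlane_mem_source₁.2 Octonion.one_ne_zero
  have h : chart₁ ∘ chart₁.symm =ᶠ[nhds (0 : Octonion × Octonion)] id := by
    filter_upwards [isOpen_domain.mem_nhds zero_mem_domain] with y hy
    exact chart₁.right_inv hy
  rw [tangentCoord, mfderiv_chart (Or.inl rfl) hs, chartAt_basePoint_apply, chartAt_basePoint,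
    h.fderiv_eq, fderiv_id]
  rfl

end OP11

/-! ### The special Osserman conditions, multiplicities and signature -/

namespace OP11

open SemiRiemannian

namespace IsModel

variable {p : OP11} {L : TangentSpace 𝓘(ℝ, Octonion × Octonion) p ≃ₗ[ℝ] Octonion × Octonion}
  {v w x : TangentSpace 𝓘(ℝ, Octonion × Octonion) p}

theorem ne_zero (hL : IsModel p L) (hv : IsUnitVector metric p v) :
    coordMetric 0 (L v) (L v) ≠ 0 := by
  rw [← hL.metric_eq]
  rcases hv with h | h <;> rw [h] <;> norm_num

theorem mem_jacobiEigenspace (hL : IsModel p L) {t : ℝ} :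
    x ∈ jacobiEigenspace metric p v t ↔
      coordJacobi coordMetric 0 (L v) (L x) = (coordMetric 0 (L v) (L v) * t) • L x := by
  rw [← hL.jacobi_eq, ← hL.metric_eq, ← map_smul, L.injective.eq_iff]
  exact sub_eq_zero

theorem mem_perp (hL : IsModel p L) : x ∈ perp metric p v ↔ coordMetric 0 (L v) (L x) = 0 := by
  rw [← hL.metric_eq]
  rfl

/-- The kernel of the defect is the octonionic line through v; as v is not null, it splits into ℝv
and its part orthogonal to v, which is the 4ε-eigenspace. -/
theorem mem_extendedEigenspace (hL : IsModel p L) (hv : IsUnitVector metric p v) :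
    x ∈ extendedEigenspace metric p v 4 ↔ defect (L v) (L x) = 0 := by
  have hε := hL.ne_zero hv
  rw [extendedEigenspace, Submodule.mem_sup]
  constructor
  · rintro ⟨y, hy, z, hz, rfl⟩
    obtain ⟨r, rfl⟩ := Submodule.mem_span_singleton.1 hy
    rw [hL.mem_jacobiEigenspace, coordJacobi_zero_eq_four_iff hε] at hz
    rw [add_comm, map_add, map_smul, defect_add_smul, hz.2, defect_self, smul_zero, add_zero]
  · intro h
    set r := coordMetric 0 (L v) (L x) / coordMetric 0 (L v) (L v) with hr
    refine ⟨r • v, Submodule.mem_span_singleton.2 ⟨r, rfl⟩, x + (-r) • v, ?_, by module⟩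
    rw [hL.mem_jacobiEigenspace, coordJacobi_zero_eq_four_iff hε, map_add, map_smul,
      defect_add_smul, h, defect_self, map_add, map_smul, smul_eq_mul, hr]
    refine ⟨?_, by simp⟩
    field_simp
    ring

/-- Both eigenspaces are graphs. A component of v that is nonzero parametrizes the first by its
Euclidean orthogonal complement, and the other component parametrizes the second by all of 𝕆. -/
theorem finrank_jacobiEigenspace (hL : IsModel p L) (hv : IsUnitVector metric p v) :
    Module.finrank ℝ (jacobiEigenspace metric p v 4) = 7 ∧
      Module.finrank ℝ (jacobiEigenspace metric p v 1) = 8 := by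
  have hε := hL.ne_zero hv
  have hfst : ∀ y : TangentSpace 𝓘(ℝ, Octonion × Octonion) p,
      (LinearMap.fst ℝ Octonion Octonion ∘ₗ L.toLinearMap) y = (L y).1 := fun _ => rfl
  have hsnd : ∀ y : TangentSpace 𝓘(ℝ, Octonion × Octonion) p,
      (LinearMap.snd ℝ Octonion Octonion ∘ₗ L.toLinearMap) y = (L y).2 := fun _ => rfl
  by_cases ha : (L v).1 = 0
  · have hb : (L v).2 ≠ 0 := fun hb => ne_zero_of_coordMetric_zero hε (Prod.ext ha hb)
    constructor
    · rw [← Octonion.finrank_orthogonal hb]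
      refine Submodule.finrank_eq_of_map (LinearMap.snd ℝ Octonion Octonion ∘ₗ L.toLinearMap)
        ?_ ?_ ?_
      · intro x hx hx0
        rw [hL.mem_jacobiEigenspace, coordJacobi_zero_four_iff_of_snd hε hb] at hx
        rw [hsnd] at hx0
        rw [hx0, Octonion.mul_zero, smul_zero] at hx
        exact (map_eq_zero_iff L L.injective).1 (Prod.ext hx.2 hx0)
      · intro x hx
        rw [hL.mem_jacobiEigenspace, coordJacobi_zero_four_iff_of_snd hε hb] at hx
        rw [hsnd, Submodule.mem_orthogonal_singleton_iff_inner_left]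
        exact hx.1
      · intro d hd
        rw [Submodule.mem_orthogonal_singleton_iff_inner_left] at hd
        refine ⟨L.symm ((1 / ‖(L v).2‖ ^ 2) • ((L v).1 * star (L v).2 * d), d), ?_, ?_⟩
        · rw [hL.mem_jacobiEigenspace, coordJacobi_zero_four_iff_of_snd hε hb,
            L.apply_symm_apply]
          exact ⟨hd, rfl⟩
        · rw [hsnd, L.apply_symm_apply]
    · rw [← Octonion.finrank_eq, ← finrank_top ℝ Octonion]
      refine Submodule.finrank_eq_of_map (LinearMap.fst ℝ Octonion Octonion ∘ₗ L.toLinearMap)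
        ?_ (fun _ _ => trivial) ?_
      · intro x hx hx0
        rw [hL.mem_jacobiEigenspace, coordJacobi_zero_eq_one_iff hε,
          defect_eq_neg_smul_iff_of_snd hb] at hx
        rw [hfst] at hx0
        rw [hx0, Octonion.mul_zero, smul_zero] at hx
        exact (map_eq_zero_iff L L.injective).1 (Prod.ext hx0 hx)
      · intro c _
        refine ⟨L.symm (c, (1 / ‖(L v).2‖ ^ 2) • ((L v).2 * star (L v).1 * c)), ?_, ?_⟩
        · rw [hL.mem_jacobiEigenspace, coordJacobi_zero_eq_one_iff hε,
            defect_eq_neg_smul_iff_of_snd hb, L.apply_symm_apply]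
        · rw [hfst, L.apply_symm_apply]
  · constructor
    · rw [← Octonion.finrank_orthogonal ha]
      refine Submodule.finrank_eq_of_map (LinearMap.fst ℝ Octonion Octonion ∘ₗ L.toLinearMap)
        ?_ ?_ ?_
      · intro x hx hx0
        rw [hL.mem_jacobiEigenspace, coordJacobi_zero_four_iff_of_fst hε ha] at hx
        rw [hfst] at hx0
        rw [hx0, Octonion.mul_zero, smul_zero] at hx
        exact (map_eq_zero_iff L L.injective).1 (Prod.ext hx0 hx.2)
      · intro x hx
        rw [hL.mem_jacobiEigenspace, coordJacobi_zero_four_iff_of_fst hε ha] at hx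
        rw [hfst, Submodule.mem_orthogonal_singleton_iff_inner_left]
        exact hx.1
      · intro c hc
        rw [Submodule.mem_orthogonal_singleton_iff_inner_left] at hc
        refine ⟨L.symm (c, (1 / ‖(L v).1‖ ^ 2) • ((L v).2 * star (L v).1 * c)), ?_, ?_⟩
        · rw [hL.mem_jacobiEigenspace, coordJacobi_zero_four_iff_of_fst hε ha,
            L.apply_symm_apply]
          exact ⟨hc, rfl⟩
        · rw [hfst, L.apply_symm_apply]
    · rw [← Octonion.finrank_eq, ← finrank_top ℝ Octonion]
      refine Submodule.finrank_eq_of_map (LinearMap.snd ℝ Octonion Octonion ∘ₗ L.toLinearMap)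
        ?_ (fun _ _ => trivial) ?_
      · intro x hx hx0
        rw [hL.mem_jacobiEigenspace, coordJacobi_zero_eq_one_iff hε,
          defect_eq_neg_smul_iff_of_fst ha] at hx
        rw [hsnd] at hx0
        rw [hx0, Octonion.mul_zero, smul_zero] at hx
        exact (map_eq_zero_iff L L.injective).1 (Prod.ext hx hx0)
      · intro d _
        refine ⟨L.symm ((1 / ‖(L v).1‖ ^ 2) • ((L v).1 * star (L v).2 * d), d), ?_, ?_⟩
        · rw [hL.mem_jacobiEigenspace, coordJacobi_zero_eq_one_iff hε,
            defect_eq_neg_smul_iff_of_fst ha, L.apply_symm_apply]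
        · rw [hsnd, L.apply_symm_apply]

theorem jacobi_mem_perp (hL : IsModel p L) (v x : TangentSpace 𝓘(ℝ, Octonion × Octonion) p) :
    jacobi metric p v x ∈ perp metric p v := by
  rw [hL.mem_perp, hL.jacobi_eq, coordMetric_zero_coordJacobi]

theorem jacobiEigenspace_four_le_perp (hL : IsModel p L) (hv : IsUnitVector metric p v) :
    jacobiEigenspace metric p v 4 ≤ perp metric p v := by
  intro x hx
  rw [hL.mem_jacobiEigenspace, coordJacobi_zero_eq_four_iff (hL.ne_zero hv)] at hx
  exact hL.mem_perp.2 hx.1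

theorem jacobiEigenspace_one_le_perp (hL : IsModel p L) (hv : IsUnitVector metric p v) :
    jacobiEigenspace metric p v 1 ≤ perp metric p v := by
  have hε := hL.ne_zero hv
  intro x hx
  rw [hL.mem_jacobiEigenspace] at hx
  have h := coordMetric_zero_coordJacobi (L v) (L x)
  rw [hx, map_smul, smul_eq_mul, mul_eq_zero, mul_one, or_iff_right hε] at h
  exact hL.mem_perp.2 h

theorem mem_eigenspace_restrict {h : ∀ x ∈ perp metric p v, jacobi metric p v x ∈ perp metric p v}
    {x : perp metric p v} {t : ℝ} :
    x ∈ Module.End.eigenspace ((jacobi metric p v).restrict h) (metric p v v * t) ↔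
      (x : TangentSpace 𝓘(ℝ, Octonion × Octonion) p) ∈ jacobiEigenspace metric p v t := by
  rw [Module.End.mem_eigenspace_iff, Subtype.ext_iff]
  exact sub_eq_zero.symm

theorem iSup_eigenspace_eq_top (hL : IsModel p L) (hv : IsUnitVector metric p v)
    (h : ∀ x ∈ perp metric p v, jacobi metric p v x ∈ perp metric p v) :
    (⨆ t : ℝ, Module.End.eigenspace ((jacobi metric p v).restrict h) t) = ⊤ := by
  have hε := hL.ne_zero hv
  rw [eq_top_iff]
  intro x _
  -- The projection -ε⁻¹N applied to x: its value y lies in the ε-eigenspace, and x - y in the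
  -- 4ε-eigenspace.
  set y : TangentSpace 𝓘(ℝ, Octonion × Octonion) p :=
    L.symm ((-(coordMetric 0 (L v) (L v))⁻¹) • defect (L v) (L x)) with hy
  have hLy : L y = (-(coordMetric 0 (L v) (L v))⁻¹) • defect (L v) (L x) := L.apply_symm_apply _
  have hdy : defect (L v) (L y) = defect (L v) (L x) := by
    have h1 := defect_add_smul (L v) 0 (defect (L v) (L x)) (-(coordMetric 0 (L v) (L v))⁻¹)
    have h0 : defect (L v) 0 = 0 := by simp [defect, Octonion.mul_zero]
    rw [zero_add, h0, zero_add, defect_defect, smul_smul, neg_mul_neg, inv_mul_cancel₀ hε,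
      one_smul] at h1
    rw [hLy, h1]
  have hy1 : y ∈ jacobiEigenspace metric p v 1 := by
    rw [hL.mem_jacobiEigenspace, coordJacobi_zero_eq_one_iff hε, hdy, hLy, smul_smul, neg_mul_neg,
      mul_inv_cancel₀ hε, one_smul]
  have hyp := hL.jacobiEigenspace_one_le_perp hv hy1
  have hz4 : (x : TangentSpace 𝓘(ℝ, Octonion × Octonion) p) + (-1 : ℝ) • y ∈
      jacobiEigenspace metric p v 4 := by
    rw [hL.mem_jacobiEigenspace, coordJacobi_zero_eq_four_iff hε, map_add, map_smul,
      defect_add_smul, hdy, map_add, map_smul, hL.mem_perp.1 hyp, hL.mem_perp.1 x.2]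
    exact ⟨by simp, by module⟩
  have hx : x = ⟨_, hL.jacobiEigenspace_four_le_perp hv hz4⟩ + ⟨y, hyp⟩ := by
    apply Subtype.ext
    change (x : TangentSpace 𝓘(ℝ, Octonion × Octonion) p) = x + (-1 : ℝ) • y + y
    module
  rw [hx]
  exact add_mem
    (Submodule.mem_iSup_of_mem (metric p v v * 4) (mem_eigenspace_restrict.2 hz4))
    (Submodule.mem_iSup_of_mem (metric p v v * 1) (mem_eigenspace_restrict.2 hy1))

theorem hasEigenvalue_restrict (h : ∀ x ∈ perp metric p v, jacobi metric p v x ∈ perp metric p v)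
    {t : ℝ} (ht : jacobiEigenspace metric p v t ≤ perp metric p v)
    (hrank : Module.finrank ℝ (jacobiEigenspace metric p v t) ≠ 0) :
    Module.End.HasEigenvalue ((jacobi metric p v).restrict h) (metric p v v * t) := by
  have hne : jacobiEigenspace metric p v t ≠ ⊥ := by
    intro h0
    rw [h0, finrank_bot] at hrank
    exact hrank rfl
  obtain ⟨x, hx, hx0⟩ := Submodule.exists_mem_ne_zero_of_ne_bot hne
  exact Module.End.hasEigenvalue_of_hasEigenvector (x := ⟨x, ht hx⟩)
    ⟨mem_eigenspace_restrict.2 hx, fun h0 => hx0 (congrArg Subtype.val h0)⟩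

theorem nonzero_eigenvalues (hL : IsModel p L) (hv : IsUnitVector metric p v)
    (h : ∀ x ∈ perp metric p v, jacobi metric p v x ∈ perp metric p v) :
    {t : ℝ | t ≠ 0 ∧ Module.End.HasEigenvalue ((jacobi metric p v).restrict h) t} =
      {metric p v v * 4, metric p v v * 1} := by
  have hε := hL.ne_zero hv
  have hε' : metric p v v ≠ 0 := by rwa [hL.metric_eq]
  have hrank := hL.finrank_jacobiEigenspace hv
  ext t
  constructor
  · rintro ⟨-, ht⟩
    obtain ⟨x, hx, hx0⟩ := ht.exists_hasEigenvector
    have h1 : L (jacobi metric p v x) = t • L x := by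
      rw [Module.End.mem_eigenspace_iff, Subtype.ext_iff] at hx
      rw [← map_smul]
      exact congrArg L hx
    rw [hL.jacobi_eq, coordJacobi_zero_eq, hL.mem_perp.1 x.2] at h1
    rw [hL.metric_eq]
    set D := defect (L v) (L x) with hD
    set r := coordMetric 0 (L v) (L v) with hr
    have hLx : L x ≠ 0 := fun h0 =>
      hx0 (Subtype.ext ((map_eq_zero_iff L L.injective).1 h0))
    have h2 : D = ((t - 4 * r) / 3) • L x := by
      have h3 : (3 : ℝ) • D = (t - 4 * r) • L x := by
        rw [sub_smul, ← h1]
        module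
      rw [div_eq_inv_mul, ← smul_smul, ← h3, smul_smul, inv_mul_cancel₀ (by norm_num), one_smul]
    -- An eigenvector x of 𝒥_v in v^⊥ is one of N, with eigenvalue (t - 4ε)/3. Comparing with N² =
    -- -εN leaves t = ε or Nx = 0, and the latter gives t = 4ε.
    have h4 : (t - r) • D = 0 := by
      have h5 := defect_add_smul (L v) 0 (L x) ((t - 4 * r) / 3)
      have h0 : defect (L v) 0 = 0 := by simp [defect, Octonion.mul_zero]
      rw [zero_add, h0, zero_add, ← h2, ← hD, hD, defect_defect, ← hD, ← hr, ← sub_eq_zero] at h5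
      have h6 : (t - r) • D = (-3 : ℝ) • ((-r) • D - ((t - 4 * r) / 3) • D) := by module
      rw [h6, h5, smul_zero]
    rcases smul_eq_zero.1 h4 with h5 | h5
    · right
      change t = r * 1
      linarith
    · left
      rw [h5, eq_comm, smul_eq_zero, or_iff_left hLx] at h2
      linarith
  · rintro (rfl | rfl)
    · exact ⟨mul_ne_zero hε' (by norm_num), hasEigenvalue_restrict h
        (hL.jacobiEigenspace_four_le_perp hv) (by rw [hrank.1]; norm_num)⟩
    · exact ⟨mul_ne_zero hε' (by norm_num), hasEigenvalue_restrict h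
        (hL.jacobiEigenspace_one_le_perp hv) (by rw [hrank.2]; norm_num)⟩

theorem extendedEigenspace_eq (hL : IsModel p L) (hv : IsUnitVector metric p v)
    (hw : IsUnitVector metric p w) (h : w ∈ extendedEigenspace metric p v 4) :
    extendedEigenspace metric p v 4 = extendedEigenspace metric p w 4 := by
  ext x
  rw [hL.mem_extendedEigenspace hv] at h
  rw [hL.mem_extendedEigenspace hv, hL.mem_extendedEigenspace hw]
  exact defect_eq_zero_congr (ne_zero_of_coordMetric_zero (hL.ne_zero hv))
    (ne_zero_of_coordMetric_zero (hL.ne_zero hw)) h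

theorem mem_jacobiEigenspace_one_symm (hL : IsModel p L) (hv : IsUnitVector metric p v)
    (h : w ∈ jacobiEigenspace metric p v 1) : v ∈ jacobiEigenspace metric p w 1 := by
  have hε := hL.ne_zero hv
  rw [hL.mem_jacobiEigenspace, coordJacobi_zero_eq_one_iff hε] at h
  have h1 := defect_swap (ne_zero_of_coordMetric_zero hε) h
  have h2 := coordMetric_zero_defect (L v) (L w)
  rw [h, map_smul, smul_eq_mul, mul_eq_zero, neg_eq_zero, or_iff_right hε,
    coordMetric_symm] at h2
  -- Since w may be null, the eigenspace criterion is not available for w, and the formula for the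
  -- Jacobi operator is used instead: 4ε_w v - 3ε_w v = ε_w v.
  rw [hL.mem_jacobiEigenspace, coordJacobi_zero_eq, h1, h2]
  module

/-- In the model the form is |c|² - |d|², so the two copies of 𝕆 bound both indices below by 8; the
total dimension 16 leaves no room for more. -/
theorem signature (hL : IsModel p L) :
    sigPos (LinearMap.BilinMap.toQuadraticMap (metric p).toBilinForm) = 8 ∧
      sigNeg (LinearMap.BilinMap.toQuadraticMap (metric p).toBilinForm) = 8 := by
  have : Module.Finite ℝ (TangentSpace 𝓘(ℝ, Octonion × Octonion) p) := Module.Finite.equiv L.symm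
  set Q := LinearMap.BilinMap.toQuadraticMap (metric p).toBilinForm with hQ
  have hQx : ∀ y, Q (L.symm y) = ‖y.1‖ ^ 2 - ‖y.2‖ ^ 2 := by
    intro y
    have h : Q (L.symm y) = metric p (L.symm y) (L.symm y) := rfl
    rw [h, hL.metric_eq, L.apply_symm_apply, coordMetric_zero_self]
  set f : Octonion →ₗ[ℝ] TangentSpace 𝓘(ℝ, Octonion × Octonion) p :=
    L.symm.toLinearMap ∘ₗ LinearMap.inl ℝ Octonion Octonion with hf
  set k : Octonion →ₗ[ℝ] TangentSpace 𝓘(ℝ, Octonion × Octonion) p :=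
    L.symm.toLinearMap ∘ₗ LinearMap.inr ℝ Octonion Octonion with hk
  have hQf : ∀ c, Q (f c) = ‖c‖ ^ 2 := fun c => by
    have h := hQx (c, 0)
    simp only [norm_zero] at h
    change Q (L.symm (c, 0)) = _
    rw [h]
    ring
  have hQk : ∀ d, (-Q) (k d) = ‖d‖ ^ 2 := fun d => by
    have h := hQx (0, d)
    simp only [norm_zero] at h
    change -Q (L.symm (0, d)) = _
    rw [h]
    ring
  have hdef : ∀ (Q' : QuadraticForm ℝ (TangentSpace 𝓘(ℝ, Octonion × Octonion) p))
      (f' : Octonion →ₗ[ℝ] TangentSpace 𝓘(ℝ, Octonion × Octonion) p),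
      (∀ c, Q' (f' c) = ‖c‖ ^ 2) → 8 ≤ sigPos Q' := by
    intro Q' f' h
    have hinj : Function.Injective f' := by
      rw [injective_iff_map_eq_zero]
      intro c hc
      have h1 := h c
      rw [hc, QuadraticMap.map_zero, eq_comm, sq_eq_zero_iff, norm_eq_zero] at h1
      exact h1
    have hr : Module.finrank ℝ (LinearMap.range f') = 8 := by
      rw [LinearMap.finrank_range_of_inj hinj, Octonion.finrank_eq]
    rw [← hr]
    refine le_sigPos_of_posDef Q' ?_
    rintro ⟨_, c, rfl⟩ hc
    change 0 < Q' (f' c)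
    rw [h]
    have hc0 : c ≠ 0 := by
      rintro rfl
      exact hc (Subtype.ext (map_zero f'))
    exact pow_pos (norm_pos_iff.2 hc0) 2
  have h1 := hdef Q f hQf
  have h2 : 8 ≤ sigNeg Q := hdef (-Q) k hQk
  have h3 := QuadraticForm.sigPos_add_sigNeg_add_radical (Q := Q)
  rw [L.finrank_eq, Module.finrank_prod, Octonion.finrank_eq] at h3
  omega

end IsModel

theorem isSpecialOsserman_metric : IsSpecialOssermanWith metric 4 1 where
  isMetric := isMetric_metric
  left_ne_zero := by norm_num
  right_ne_zero := by norm_num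
  ne := by norm_num
  condition_I p v hv := by
    obtain ⟨L, hL⟩ := exists_isModel p
    exact ⟨fun x _ => hL.jacobi_mem_perp v x, hL.iSup_eigenspace_eq_top hv _,
      hL.nonzero_eigenvalues hv _⟩
  condition_II p v w hv hw h := by
    obtain ⟨L, hL⟩ := exists_isModel p
    exact hL.extendedEigenspace_eq hv hw h
  condition_III p v w hv h := by
    obtain ⟨L, hL⟩ := exists_isModel p
    exact hL.mem_jacobiEigenspace_one_symm hv h

theorem mem_jacobiEigenspace_basePoint {v x : TangentSpace 𝓘(ℝ, Octonion × Octonion) basePoint}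
    {t : ℝ} : x ∈ jacobiEigenspace metric basePoint v t ↔
      coordJacobi coordMetric 0 (tangentCoord v) (tangentCoord x) =
        (coordMetric 0 (tangentCoord v) (tangentCoord v) * t) • tangentCoord x := by
  rw [isModel_basePoint.mem_jacobiEigenspace, tangentCoord_apply, tangentCoord_apply]
  rfl

theorem ne_zero_of_isUnitVector_basePoint
    {v : TangentSpace 𝓘(ℝ, Octonion × Octonion) basePoint}
    (hv : IsUnitVector metric basePoint v) :
    coordMetric 0 (tangentCoord v) (tangentCoord v) ≠ 0 := by
  rw [tangentCoord_apply]
  exact isModel_basePoint.ne_zero hv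

end OP11

theorem mainTheorem4 :
    -- in each of the two charts the metric is given by the defining formula
    (∀ e ∈ atlas (Octonion × Octonion) OP11, ∀ p ∈ e.source,
      ∀ v w : TangentSpace 𝓘(ℝ, Octonion × Octonion) p,
        OP11.metric p v w = OP11.coordMetric (e p)
          (mfderiv 𝓘(ℝ, Octonion × Octonion) 𝓘(ℝ, Octonion × Octonion) e p v)
          (mfderiv 𝓘(ℝ, Octonion × Octonion) 𝓘(ℝ, Octonion × Octonion) e p w)) ∧
    SemiRiemannian.HasSignature OP11.metric 8 8 ∧
    -- the special Osserman conditions hold at every point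
    SemiRiemannian.IsSpecialOssermanWith OP11.metric 4 1 ∧
    -- multiplicities of the eigenvalues
    (∀ (p : OP11) (v : TangentSpace 𝓘(ℝ, Octonion × Octonion) p),
      SemiRiemannian.IsUnitVector OP11.metric p v →
        Module.finrank ℝ (SemiRiemannian.jacobiEigenspace OP11.metric p v 4) = 7 ∧
        Module.finrank ℝ (SemiRiemannian.jacobiEigenspace OP11.metric p v 1) = 8) ∧
    -- the eigenspaces at the point `[1, 0, 0]`
    (∀ (v : TangentSpace 𝓘(ℝ, Octonion × Octonion) OP11.basePoint) (a b : Octonion),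
      SemiRiemannian.IsUnitVector OP11.metric OP11.basePoint v → OP11.tangentCoord v = (a, b) →
      (a ≠ 0 →
        (SemiRiemannian.jacobiEigenspace OP11.metric OP11.basePoint v 4 : Set _) =
          OP11.tangentCoord ⁻¹'
            {x | ∃ c : Octonion, inner ℝ c a = 0 ∧ x = (c, (1 / ‖a‖ ^ 2) • ((b * star a) * c))} ∧
        (SemiRiemannian.jacobiEigenspace OP11.metric OP11.basePoint v 1 : Set _) =
          OP11.tangentCoord ⁻¹'
            {x | ∃ d : Octonion, x = ((1 / ‖a‖ ^ 2) • ((a * star b) * d), d)}) ∧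
      (b ≠ 0 →
        (SemiRiemannian.jacobiEigenspace OP11.metric OP11.basePoint v 4 : Set _) =
          OP11.tangentCoord ⁻¹'
            {x | ∃ d : Octonion, inner ℝ d b = 0 ∧ x = ((1 / ‖b‖ ^ 2) • ((a * star b) * d), d)} ∧
        (SemiRiemannian.jacobiEigenspace OP11.metric OP11.basePoint v 1 : Set _) =
          OP11.tangentCoord ⁻¹'
            {x | ∃ c : Octonion, x = (c, (1 / ‖b‖ ^ 2) • ((b * star a) * c))})) := by
  refine ⟨fun e he p hp v w => OP11.metric_eq_coordMetric he hp v w, fun p => ?_,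
    OP11.isSpecialOsserman_metric, fun p v hv => ?_, fun v a b hv hab => ?_⟩
  · obtain ⟨L, hL⟩ := OP11.exists_isModel p
    exact hL.signature
  · obtain ⟨L, hL⟩ := OP11.exists_isModel p
    exact hL.finrank_jacobiEigenspace hv
  -- Once `tangentCoord x` is generalized, each description is a graph in 𝕆², matched with the
  -- corresponding solved form of the eigenvalue equation.
  · have hε := OP11.ne_zero_of_isUnitVector_basePoint hv
    rw [hab] at hε
    constructor <;> intro h <;> constructor <;> ext x <;>
      rw [SetLike.mem_coe, OP11.mem_jacobiEigenspace_basePoint, hab, Set.mem_preimage] <;>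
      generalize OP11.tangentCoord x = y
    · rw [OP11.coordJacobi_zero_four_iff_of_fst hε h]
      exact ⟨fun h' => ⟨y.1, h'.1, Prod.ext rfl h'.2⟩, by rintro ⟨c, hc, rfl⟩; exact ⟨hc, rfl⟩⟩
    · rw [OP11.coordJacobi_zero_eq_one_iff hε, OP11.defect_eq_neg_smul_iff_of_fst h]
      exact ⟨fun h' => ⟨y.2, Prod.ext h' rfl⟩, by rintro ⟨d, rfl⟩; rfl⟩
    · rw [OP11.coordJacobi_zero_four_iff_of_snd hε h]
      exact ⟨fun h' => ⟨y.2, h'.1, Prod.ext h'.2 rfl⟩, by rintro ⟨d, hd, rfl⟩; exact ⟨hd, rfl⟩⟩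
    · rw [OP11.coordJacobi_zero_eq_one_iff hε, OP11.defect_eq_neg_smul_iff_of_snd h]
      exact ⟨fun h' => ⟨y.1, Prod.ext rfl h'⟩, by rintro ⟨c, rfl⟩; rfl⟩
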